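/- For a real number $\xi$ let $\mu(\xi)\in[1,\infty]$ be its irrationality exponent, i.e. the supremum of all $t$ for which $|\xi-p/q|\le q^{-t}$ holds for infinitely many rational numbers $p/q$ (in lowest terms, $q>0$). For $2\le\lambda\le\mu\le\infty$ let $\mathscr{W}_{\lambda;\mu}=\{\xi\in\mathbb{R}:\lambda\le\mu(\xi)\le\mu\}$. Let $n\ge 1$ be an integer. Call $(\lambda_0,\dots,\lambda_{n-1};\mu_0,\dots,\mu_{n-1})$ admissible if for every $0\le i\le n-1$ we have $\lambda_i\in[2,\infty]$, $\mu_i\in[\lambda_i,\infty]$ and $$\mu_i>\frac{\lambda_0\lambda_1\cdots\lambda_{n-1}}{\lambda_i-1}+1,$$ where the last condition is regarded as satisfied if $\mu_i=\infty$ (and as violated if $\mu_i<\infty$ and some $\lambda_j=\infty$). Then $$\lim_{\max\lambda_i\to\infty}\dim\Big(\prod_{i=0}^{n-1}\mathscr{W}_{\lambda_i;\mu_i}\Big)=n-1,\qquad \lim_{\max\lambda_i\to\infty}\dim_P\Big(\prod_{i=0}^{n-1}\mathscr{W}_{\lambda_i;\mu_i}\Big)=n,$$ where $\dim$ and $\dim_P$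 denote Hausdorff and packing dimension in Euclidean space $\mathbb{R}^n$. The limits are uniform over all admissible parameters: for every $\varepsilon>0$ there is $M<\infty$ (depending on $n$ and $\varepsilon$) such that for all admissible parameters with $M<\max_i\lambda_i\le\infty$ the two dimensions differ from $n-1$ and $n$, respectively, by less than $\varepsilon$. -/

import Mathlib

open Set Filter Topology
open scoped ENNReal NNReal

noncomputable section

namespace DiophProd

/-! ### Packing measures and packing dimension -/

section Packing

variable {X : Type*} [PseudoMetricSpace X]

/-- `P` is a `δ`-packing of `A`: a countable family of pairwise disjoint closed balls, given as
pairs (centre, radius), with centres in `A` and radii in `(0, δ]`. -/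
def IsPacking (δ : ℝ) (A : Set X) (P : Set (X × ℝ)) : Prop :=
  P.Countable ∧ (∀ p ∈ P, p.1 ∈ A ∧ 0 < p.2 ∧ p.2 ≤ δ) ∧
    P.PairwiseDisjoint (fun p => Metric.closedBall p.1 p.2)

/-- The supremum of `∑ (2 r_j) ^ s` over all `δ`-packings of `A` by balls of radii `r_j`.
In a Euclidean space of positive dimension `2 r` is the diameter of a ball of radius `r`. -/
def packingSup (s : ℝ≥0) (δ : ℝ) (A : Set X) : ℝ≥0∞ :=
  ⨆ (P : Set (X × ℝ)) (_ : IsPacking δ A P), ∑' p : P, ENNReal.ofReal (2 * p.1.2) ^ (s : ℝ)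

/-- The `s`-dimensional packing premeasure: the (decreasing) limit of `packingSup s δ A` as
`δ → 0`. -/
def packingPremeasure (s : ℝ≥0) (A : Set X) : ℝ≥0∞ :=
  ⨅ (δ : ℝ) (_ : 0 < δ), packingSup s δ A

/-- The `s`-dimensional packing measure of `A`. -/
def packingMeasure (s : ℝ≥0) (A : Set X) : ℝ≥0∞ :=
  ⨅ (U : ℕ → Set X) (_ : A ⊆ ⋃ j, U j), ∑' j, packingPremeasure s (U j)

/-- The packing dimension of `A`: the supremum of all `s ≥ 0` for which the `s`-dimensional packing
measure of `A` is infinite. -/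
def dimPacking (A : Set X) : ℝ≥0∞ :=
  ⨆ (s : ℝ≥0) (_ : packingMeasure s A = ∞), (s : ℝ≥0∞)

end Packing

/-! ### Irrationality exponents and their level sets -/

/-- The irrationality exponent of `ξ`: the supremum of all `t` such that `|ξ - p/q| ≤ q ^ (-t)` for
infinitely many rational numbers `p/q` (in lowest terms, `q > 0`). Every `t ≤ 0` has this property,
so only `t ≥ 0` is considered. -/
def irrationalityExponent (ξ : ℝ) : ℝ≥0∞ :=
  ⨆ (t : ℝ≥0) (_ : {r : ℚ | |ξ - (r : ℝ)| ≤ (r.den : ℝ) ^ (-(t : ℝ))}.Infinite), (t : ℝ≥0∞)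

/-- The set `W_{l;m}` of all real numbers with irrationality exponent in `[l, m]`. -/
def W (l m : ℝ≥0∞) : Set ℝ :=
  {ξ | l ≤ irrationalityExponent ξ ∧ irrationalityExponent ξ ≤ m}

/-- The Cartesian product `∏ i, W_{l i; m i}` as a subset of Euclidean space `ℝⁿ`. -/
def prodW {n : ℕ} (l m : Fin n → ℝ≥0∞) : Set (EuclideanSpace ℝ (Fin n)) :=
  {x | ∀ i, x i ∈ W (l i) (m i)}

/-- The admissible parameters `(l, m)`: all `l i` are in `[2, ∞]`, and `m i ≥ l i` and
`m i > (∏ j, l j) / (l i - 1) + 1`; the last condition is regarded as satisfied if `m i = ∞`. -/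
def admissible (n : ℕ) : Set ((Fin n → ℝ≥0∞) × (Fin n → ℝ≥0∞)) :=
  {p | ∀ i, 2 ≤ p.1 i ∧ p.1 i ≤ p.2 i ∧
    (p.2 i = ∞ ∨ (∏ j, p.1 j) / (p.1 i - 1) + 1 < p.2 i)}

/-- The filter "`max_i l i → ∞` along admissible `(l, m)`": its basic sets consist of all
admissible `(l, m)` with `max_i l i > M`, where `M < ∞` (the value `max_i l i = ∞` is allowed). -/
def maxToInfty (n : ℕ) : Filter ((Fin n → ℝ≥0∞) × (Fin n → ℝ≥0∞)) :=
  comap (fun p => ⨆ i, p.1 i) (𝓝 ∞) ⊓ 𝓟 (admissible n)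

end DiophProd

end

namespace DiophProd

open MeasureTheory

/-! ### Packing sums and coverings by balls -/

section Packing

variable {X : Type*} [PseudoMetricSpace X]

/-! Everything rests on the product inequality dim(A × B) ≤ dim A + dim_P B (`dimH_prod_le`), used
three times.

Upper bound for dim: in the coordinate where `l i` is largest, the easy half of the
Jarník–Besicovitch theorem gives dim W ≤ 2 / `l i` (`dimH_W_le`). The other coordinates contribute
at most n - 1. The bound dim_P ≤ n is a volume estimate.

Lower bounds: for almost every z in ℝⁿ there is a real x with every z i - x in its level set
(`exists_sub_mem_W`). So `prodW` plus the diagonal line has full measure, and n ≤ dim `prodW` + 1.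
For dim_P, adjoin one more coordinate ranging over `W ∞ ∞`, which has dimension 0. The same bound in
ℝⁿ⁺¹ gives n ≤ dim(`W ∞ ∞` × `prodW`) ≤ 0 + dim_P `prodW`.

The point x is found by nested intervals (`exists_approximation_sequence`). At each stage one
coordinate z i - x is placed at distance between q^(-τ)/2 and q^(-τ) from a rational r with
denominator q. In all coordinates, every other rational r' with denominator q' in the window of that
stage is kept at distance c/q'^3. The danger is a coincidence: placing z i - x near r puts z j - x
near z j - z i + r, which might be close to some r'. By Borel–Cantelli such resonances are finite in
number for generic data (`ae_finite_resonances`). The exponent of z i - x then lies between `l i`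
and max(`l i`, 3), and admissibility matters only through `m i` ≥ 3. -/

theorem card_mul_le_packingSup {s : ℝ≥0} {δ r : ℝ} {A : Set X} {F : Finset X}
    (hr : 0 < r) (hrδ : r ≤ δ) (hF : (F : Set X) ⊆ A)
    (hd : (F : Set X).PairwiseDisjoint fun x => Metric.closedBall x r) :
    (F.card : ℝ≥0∞) * ENNReal.ofReal (2 * r) ^ (s : ℝ) ≤ packingSup s δ A := by
  have hinj : Set.InjOn (fun x : X => (x, r)) (F : Set X) := fun x _ y _ h => (Prod.ext_iff.1 h).1
  have hP : IsPacking δ A ((fun x => (x, r)) '' (F : Set X)) := by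
    refine ⟨F.countable_toSet.image _, ?_, ?_⟩
    · rintro _ ⟨x, hx, rfl⟩
      exact ⟨hF hx, hr, hrδ⟩
    · rw [hinj.pairwiseDisjoint_image]
      exact hd
  refine le_trans (le_of_eq ?_) (le_iSup₂_of_le _ hP le_rfl)
  rw [tsum_image (fun p : X × ℝ => ENNReal.ofReal (2 * p.2) ^ (s : ℝ)) hinj]
  simp

/-- A set with finite packing supremum can be covered by few balls. -/
theorem exists_finset_cover_of_packingSup_ne_top {s : ℝ≥0} {δ r : ℝ} {A : Set X}
    (h : packingSup s δ A ≠ ∞) (hr : 0 < r) (hrδ : r ≤ δ) :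
    ∃ F : Finset X, A ⊆ ⋃ x ∈ F, Metric.closedBall x (2 * r) ∧
      (F.card : ℝ≥0∞) * ENNReal.ofReal (2 * r) ^ (s : ℝ) ≤ packingSup s δ A := by
  classical
  let S : Set ℕ := {k | ∃ F : Finset X, F.card = k ∧ (F : Set X) ⊆ A ∧
    (F : Set X).PairwiseDisjoint fun x => Metric.closedBall x r}
  have hpos : 0 < ENNReal.ofReal (2 * r) ^ (s : ℝ) :=
    ENNReal.rpow_pos (by simpa using hr) ENNReal.ofReal_ne_top
  have hbdd : BddAbove S := by
    obtain ⟨N, hN⟩ := ENNReal.exists_nat_gt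
      (ENNReal.div_ne_top h hpos.ne' : packingSup s δ A / ENNReal.ofReal (2 * r) ^ (s : ℝ) ≠ ∞)
    refine ⟨N, ?_⟩
    rintro k ⟨F, rfl, hF, hd⟩
    have h1 := card_mul_le_packingSup (s := s) hr hrδ hF hd
    have h2 : (F.card : ℝ≥0∞) ≤ packingSup s δ A / ENNReal.ofReal (2 * r) ^ (s : ℝ) := by
      rw [ENNReal.le_div_iff_mul_le (Or.inl hpos.ne') (Or.inr h)]
      exact h1
    exact_mod_cast (h2.trans hN.le)
  have hne : S.Nonempty := ⟨0, ∅, by simp⟩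
  obtain ⟨F, hcard, hF, hd⟩ := Nat.sSup_mem hne hbdd
  refine ⟨F, fun x hx => ?_, card_mul_le_packingSup hr hrδ hF hd⟩
  -- F is a disjoint family of maximal size; a point farther than 2r from all centres could be added
  -- to it.
  by_contra hxF
  simp only [mem_iUnion, not_exists, Metric.mem_closedBall, not_le] at hxF
  have hxnot : x ∉ F := fun hm => by
    have := hxF x hm
    rw [dist_self] at this
    linarith
  have hmem : (insert x F).card ∈ S := by
    refine ⟨insert x F, rfl, ?_, ?_⟩
    · rw [Finset.coe_insert]
      exact insert_subset hx hF
    · rw [Finset.coe_insert]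
      refine hd.insert fun y hy _ => ?_
      exact Metric.closedBall_disjoint_closedBall (by linarith [hxF y hy])
  have := le_csSup hbdd hmem
  rw [Finset.card_insert_of_notMem hxnot] at this
  omega

theorem packingMeasure_ne_top_of_dimPacking_lt {s : ℝ≥0} {A : Set X} (h : dimPacking A < s) :
    packingMeasure s A ≠ ∞ := fun h' =>
  (lt_of_lt_of_le h (le_iSup₂_of_le (f := fun (s : ℝ≥0) (_ : packingMeasure s A = ∞) => (s : ℝ≥0∞))
    s h' le_rfl)).false

end Packing

/-! ### Packing dimension is at most the dimension of the space -/

section FiniteDimensional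

variable {E : Type*} [NormedAddCommGroup E] [NormedSpace ℝ E] [FiniteDimensional ℝ E]

/-- Write (2r)^s as (2r)^(s-d) (2r)^d. The first factor is at most (2δ)^(s-d), the second is
proportional to the volume of the ball, and the balls are disjoint inside a ball of radius R + 1.
The bound tends to 0 with δ. -/
theorem packingSup_le_of_subset_ball [MeasurableSpace E] [BorelSpace E] (μ : Measure E)
    [μ.IsAddHaarMeasure] {s : ℝ≥0} (hs : (Module.finrank ℝ E : ℝ) < s) {δ R : ℝ}
    (hδ : δ ≤ 1) {A : Set E} (hA : A ⊆ Metric.closedBall 0 R) :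
    packingSup s δ A ≤ ENNReal.ofReal (2 * δ) ^ ((s : ℝ) - Module.finrank ℝ E) *
      ((μ (Metric.ball 0 1))⁻¹ * 2 ^ Module.finrank ℝ E * μ (Metric.closedBall 0 (R + 1))) := by
  set d := Module.finrank ℝ E
  set c := μ (Metric.ball 0 1)
  have hc0 : c ≠ 0 := (Metric.measure_ball_pos μ 0 one_pos).ne'
  have hct : c ≠ ∞ := measure_ball_lt_top.ne
  refine iSup₂_le fun P hP => ?_
  have key : ∀ p : P, ENNReal.ofReal (2 * p.1.2) ^ (s : ℝ) ≤
      ENNReal.ofReal (2 * δ) ^ ((s : ℝ) - d) *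
        (c⁻¹ * 2 ^ d * μ (Metric.closedBall p.1.1 p.1.2)) := by
    rintro ⟨p, hp⟩
    obtain ⟨-, hr, hrδ⟩ := hP.2.1 p hp
    dsimp only
    have h0 : ENNReal.ofReal (2 * p.2) ≠ 0 := by simpa using hr
    have e1 : (s : ℝ) = ((s : ℝ) - d) + d := by ring
    rw [Measure.addHaar_closedBall μ p.1 hr.le]
    conv_lhs => rw [e1]
    rw [ENNReal.rpow_add _ _ h0 ENNReal.ofReal_ne_top, ENNReal.rpow_natCast]
    refine mul_le_mul' (ENNReal.rpow_le_rpow (ENNReal.ofReal_le_ofReal (by linarith))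
      (by linarith)) (le_of_eq ?_)
    rw [ENNReal.ofReal_mul (by norm_num), mul_pow, ENNReal.ofReal_pow hr.le,
      ENNReal.ofReal_ofNat]
    calc (2 : ℝ≥0∞) ^ d * ENNReal.ofReal p.2 ^ d
        = (c⁻¹ * c) * (2 ^ d * ENNReal.ofReal p.2 ^ d) := by
          rw [ENNReal.inv_mul_cancel hc0 hct, one_mul]
      _ = c⁻¹ * 2 ^ d * (ENNReal.ofReal p.2 ^ d * c) := by ring
  refine (ENNReal.tsum_le_tsum key).trans ?_
  rw [ENNReal.tsum_mul_left, ENNReal.tsum_mul_left]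
  gcongr
  have : Countable P := hP.1.to_subtype
  rw [← measure_iUnion]
  · refine measure_mono (iUnion_subset ?_)
    rintro ⟨p, hp⟩ y hy
    obtain ⟨h1, -, h2⟩ := hP.2.1 p hp
    have h3 := hA h1
    rw [Metric.mem_closedBall] at *
    linarith [dist_triangle y p.1 0]
  · intro p q hpq
    exact hP.2.2 p.2 q.2 fun h => hpq (Subtype.ext h)
  · exact fun _ => measurableSet_closedBall

theorem packingMeasure_eq_zero_of_finrank_lt {s : ℝ≥0} (hs : (Module.finrank ℝ E : ℝ) < s)
    (A : Set E) : packingMeasure s A = 0 := by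
  borelize E
  let μ : Measure E := Measure.addHaar
  have hpre : ∀ j : ℕ, packingPremeasure s (Metric.closedBall (0 : E) j) = 0 := by
    intro j
    set K : ℝ≥0∞ := (μ (Metric.ball 0 1))⁻¹ * 2 ^ Module.finrank ℝ E *
      μ (Metric.closedBall 0 ((j : ℝ) + 1))
    have hK : K ≠ ∞ := by
      refine ENNReal.mul_ne_top (ENNReal.mul_ne_top ?_ (by finiteness))
        measure_closedBall_lt_top.ne
      exact ENNReal.inv_ne_top.2 (Metric.measure_ball_pos μ 0 one_pos).ne'
    have hlim : Tendsto (fun δ : ℝ => ENNReal.ofReal (2 * δ) ^ ((s : ℝ) - Module.finrank ℝ E) * K)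
        (𝓝[>] 0) (𝓝 0) := by
      have h1 : Tendsto (fun δ : ℝ => ENNReal.ofReal (2 * δ)) (𝓝[>] 0) (𝓝 0) := by
        have : Tendsto (fun δ : ℝ => ENNReal.ofReal (2 * δ)) (𝓝 0) (𝓝 (ENNReal.ofReal (2 * 0))) :=
          (ENNReal.continuous_ofReal.comp (continuous_const.mul continuous_id)).tendsto 0
        simp only [mul_zero, ENNReal.ofReal_zero] at this
        exact this.mono_left nhdsWithin_le_nhds
      have hp : 0 < (s : ℝ) - Module.finrank ℝ E := by linarith
      have h2 := (ENNReal.continuous_rpow_const (y := (s : ℝ) - Module.finrank ℝ E)).tendsto 0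
      rw [ENNReal.zero_rpow_of_pos hp] at h2
      have h3 := ENNReal.Tendsto.mul_const (b := K) (h2.comp h1) (Or.inr hK)
      simpa using h3
    refine le_antisymm (ge_of_tendsto hlim ?_) zero_le
    filter_upwards [Ioc_mem_nhdsGT (zero_lt_one' ℝ)] with δ hδ
    exact (iInf₂_le δ hδ.1).trans (packingSup_le_of_subset_ball μ hs hδ.2 subset_rfl)
  refine le_antisymm ?_ zero_le
  refine iInf₂_le_of_le (fun j : ℕ => Metric.closedBall (0 : E) j) ?_ ?_
  · rw [Metric.iUnion_closedBall_nat]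
    exact subset_univ _
  · simp [hpre]

theorem dimPacking_le_finrank (A : Set E) : dimPacking A ≤ Module.finrank ℝ E := by
  refine iSup₂_le fun s hs => ?_
  by_contra h
  push Not at h
  have : (Module.finrank ℝ E : ℝ) < s := by exact_mod_cast h
  rw [packingMeasure_eq_zero_of_finrank_lt this] at hs
  exact ENNReal.zero_ne_top hs

end FiniteDimensional

/-! ### Hausdorff dimension of products -/

section Product

variable {X Y : Type*} [MetricSpace X] [MetricSpace Y]

/-- The radii must be positive because they serve as scales for covering the second factor, but the
covering sets may have diameter 0. -/
theorem exists_cover_of_hausdorffMeasure_eq_zero [MeasurableSpace X] [BorelSpace X] {s : ℝ}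
    (hs : 0 < s) {A : Set X} (hA : μH[s] A = 0) {ε : ℝ≥0∞} (hε : ε ≠ 0) {ρ : ℝ} (hρ : 0 < ρ) :
    ∃ (V : ℕ → Set X) (r : ℕ → ℝ), A ⊆ ⋃ k, V k ∧
      (∀ k, 0 < r k ∧ r k ≤ ρ ∧ Metric.ediam (V k) ≤ ENNReal.ofReal (r k)) ∧
      ∑' k, ENNReal.ofReal (r k) ^ s ≤ ε := by
  have hε2 : ε / 2 ≠ 0 := (ENNReal.half_pos hε).ne'
  obtain ⟨η, hη, hηs⟩ := ENNReal.exists_pos_sum_of_countable' hε2 ℕ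
  rw [Measure.hausdorffMeasure_apply] at hA
  simp only [ENNReal.iSup_eq_zero] at hA
  have h1 := hA (ENNReal.ofReal ρ) (ENNReal.ofReal_pos.2 hρ)
  have h2 := h1.trans_lt (pos_iff_ne_zero.2 hε2)
  simp only [iInf_lt_iff] at h2
  obtain ⟨V, hV, hVd, hVs⟩ := h2
  -- Diameters are raised to a positive floor whose s-th powers add up to at most ε / 2.
  set R : ℕ → ℝ≥0∞ := fun k =>
    max (Metric.ediam (V k)) (min (ENNReal.ofReal ρ) (η k ^ (1 / s)))
  have hRρ : ∀ k, R k ≤ ENNReal.ofReal ρ := fun k => max_le (hVd k) (min_le_left _ _)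
  have hRt : ∀ k, R k ≠ ∞ := fun k => ne_top_of_le_ne_top ENNReal.ofReal_ne_top (hRρ k)
  have hR0 : ∀ k, 0 < R k := fun k => lt_max_of_lt_right
    (lt_min (ENNReal.ofReal_pos.2 hρ) (by
      rcases eq_or_ne (η k) ∞ with h | h
      · rw [h, ENNReal.top_rpow_of_pos (by positivity)]; exact ENNReal.zero_lt_top
      · exact ENNReal.rpow_pos (hη k) h))
  refine ⟨V, fun k => (R k).toReal, hV, fun k => ⟨ENNReal.toReal_pos (hR0 k).ne' (hRt k),
    ENNReal.toReal_le_of_le_ofReal hρ.le (hRρ k), ?_⟩, ?_⟩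
  · rw [ENNReal.ofReal_toReal (hRt k)]
    exact le_max_left _ _
  · have hk : ∀ k, ENNReal.ofReal (R k).toReal ^ s ≤
        (⨆ _ : (V k).Nonempty, Metric.ediam (V k) ^ s) + η k := by
      intro k
      rw [ENNReal.ofReal_toReal (hRt k)]
      rcases le_total (Metric.ediam (V k)) (min (ENNReal.ofReal ρ) (η k ^ (1 / s))) with h | h
      · have : R k ≤ η k ^ (1 / s) := by
          simp only [R, max_eq_right h]
          exact min_le_right _ _
        calc R k ^ s ≤ (η k ^ (1 / s)) ^ s := ENNReal.rpow_le_rpow this hs.le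
          _ = η k := by
            rw [← ENNReal.rpow_mul, one_div, inv_mul_cancel₀ hs.ne', ENNReal.rpow_one]
          _ ≤ _ := le_add_self
      · have : R k = Metric.ediam (V k) := max_eq_left h
        rw [this]
        rcases (V k).eq_empty_or_nonempty with h' | h'
        · simp [h', hs]
        · simp [h']
    calc ∑' k, ENNReal.ofReal (R k).toReal ^ s
        ≤ ∑' k, ((⨆ _ : (V k).Nonempty, Metric.ediam (V k) ^ s) + η k) := ENNReal.tsum_le_tsum hk
      _ = _ := ENNReal.tsum_add
      _ ≤ ε / 2 + ε / 2 := add_le_add hVs.le hηs.le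
      _ = ε := ENNReal.add_halves ε

/-- Cover A by sets of diameter at most r_k with ∑ r_k^s small, and U by N_k balls of radius r_k.
Finite packing sums force N_k r_k^t ≤ C, so the products have total (s+t)-sum at most 2^(s+t) C ∑
r_k^s. -/
theorem hausdorffMeasure_prod_eq_zero [MeasurableSpace X] [BorelSpace X]
    [MeasurableSpace (X × Y)] [BorelSpace (X × Y)] {s t : ℝ≥0}
    (hs : 0 < s) {A : Set X} {U : Set Y} (hA : μH[s] A = 0) (hU : packingPremeasure t U ≠ ∞) :
    μH[(s + t : ℝ≥0)] (A ×ˢ U) = 0 := by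
  obtain ⟨δ, hδ, hC⟩ : ∃ δ : ℝ, 0 < δ ∧ packingSup t δ U ≠ ∞ := by
    by_contra! h
    exact hU (by simp only [packingPremeasure, iInf_eq_top]; exact h)
  set C := packingSup t δ U
  have hs' : (0 : ℝ) < s := hs
  have hcov : ∀ n : ℕ, ∃ (V : ℕ → Set X) (r : ℕ → ℝ), A ⊆ ⋃ k, V k ∧
      (∀ k, 0 < r k ∧ r k ≤ min (2 * δ) (1 / (n + 1)) ∧
        Metric.ediam (V k) ≤ ENNReal.ofReal (r k)) ∧
      ∑' k, ENNReal.ofReal (r k) ^ (s : ℝ) ≤ ENNReal.ofReal (1 / (n + 1)) := fun n =>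
    exists_cover_of_hausdorffMeasure_eq_zero hs' hA
      (ENNReal.ofReal_pos.2 (by positivity)).ne' (lt_min (by positivity) (by positivity))
  choose V r hV hr hsum using hcov
  have hnet : ∀ n k, ∃ F : Finset Y, U ⊆ ⋃ x ∈ F, Metric.closedBall x (r n k) ∧
      (F.card : ℝ≥0∞) * ENNReal.ofReal (r n k) ^ (t : ℝ) ≤ C := by
    intro n k
    obtain ⟨h1, h2, -⟩ := hr n k
    have h3 : r n k / 2 ≤ δ := by linarith [h2.trans (min_le_left _ _)]
    have := exists_finset_cover_of_packingSup_ne_top hC (half_pos h1) h3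
    rwa [mul_div_cancel₀ _ (two_ne_zero' ℝ)] at this
  choose F hF hFc using hnet
  have hlim : Tendsto (fun n : ℕ => (1 / ((n : ℝ) + 1))) atTop (𝓝 0) :=
    tendsto_one_div_add_atTop_nhds_zero_nat
  have hlimE : ∀ K : ℝ≥0∞, K ≠ ∞ →
      Tendsto (fun n : ℕ => K * ENNReal.ofReal (1 / ((n : ℝ) + 1))) atTop (𝓝 0) := by
    intro K hK
    have h2 := ENNReal.Tendsto.const_mul (ENNReal.tendsto_ofReal hlim) (Or.inr hK)
    simpa using h2
  have key := Measure.hausdorffMeasure_le_liminf_tsum (X := X × Y) ((s + t : ℝ≥0) : ℝ) (A ×ˢ U)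
    (ι := fun n => Σ k, F n k) (fun n : ℕ => 2 * ENNReal.ofReal (1 / ((n : ℝ) + 1)))
    (hlimE 2 (by simp))
    (fun n i => V n i.1 ×ˢ Metric.closedBall (i.2 : Y) (r n i.1)) ?_ ?_
  · refine le_antisymm (key.trans ?_) zero_le
    have hst : (0 : ℝ) ≤ s + t := by positivity
    set K : ℝ≥0∞ := 2 ^ ((s : ℝ) + t) * C
    have hK : K ≠ ∞ := ENNReal.mul_ne_top
      (ENNReal.rpow_ne_top_of_nonneg hst (by simp)) hC
    have hbound : ∀ n : ℕ, ∑' i : Σ k, F n k,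
        Metric.ediam (V n i.1 ×ˢ Metric.closedBall (i.2 : Y) (r n i.1)) ^ ((s + t : ℝ≥0) : ℝ)
          ≤ K * ENNReal.ofReal (1 / ((n : ℝ) + 1)) := by
      intro n
      rw [ENNReal.tsum_sigma']
      refine le_trans ?_ (mul_le_mul_right (hsum n) K)
      rw [← ENNReal.tsum_mul_left]
      refine ENNReal.tsum_le_tsum fun k => ?_
      obtain ⟨h1, h2, h3⟩ := hr n k
      calc ∑' y : F n k, Metric.ediam (V n k ×ˢ Metric.closedBall (y : Y) (r n k))
              ^ ((s + t : ℝ≥0) : ℝ)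
          ≤ ∑' _ : F n k, (2 * ENNReal.ofReal (r n k)) ^ ((s : ℝ) + t) := by
            refine ENNReal.tsum_le_tsum fun y => ?_
            rw [NNReal.coe_add]
            refine ENNReal.rpow_le_rpow (Metric.ediam_le fun p hp q hq => ?_) hst
            rw [Prod.edist_eq]
            refine max_le ?_ ?_
            · refine (Metric.edist_le_ediam_of_mem hp.1 hq.1).trans (h3.trans ?_)
              exact le_mul_of_one_le_left zero_le one_le_two
            · have a1 := Metric.mem_closedBall.1 hp.2
              have a2 := Metric.mem_closedBall.1 hq.2
              rw [edist_dist, ← ENNReal.ofReal_ofNat 2, ← ENNReal.ofReal_mul (by norm_num)]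
              refine ENNReal.ofReal_le_ofReal ?_
              linarith [dist_triangle_right p.2 q.2 (y : Y)]
        _ = (F n k).card * (2 * ENNReal.ofReal (r n k)) ^ ((s : ℝ) + t) := by simp
        _ = 2 ^ ((s : ℝ) + t) * ((F n k).card * ENNReal.ofReal (r n k) ^ (t : ℝ)) *
              ENNReal.ofReal (r n k) ^ (s : ℝ) := by
            rw [ENNReal.mul_rpow_of_nonneg _ _ hst,
              ENNReal.rpow_add (x := ENNReal.ofReal (r n k)) _ _ (ENNReal.ofReal_pos.2 h1).ne'
                ENNReal.ofReal_ne_top]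
            ring
        _ ≤ K * ENNReal.ofReal (r n k) ^ (s : ℝ) := by
            exact mul_le_mul' (mul_le_mul' le_rfl (hFc n k)) le_rfl
    refine (liminf_le_liminf (Eventually.of_forall hbound)).trans ?_
    exact (hlimE K hK).liminf_eq.le
  · refine Eventually.of_forall fun n i => Metric.ediam_le fun p hp q hq => ?_
    obtain ⟨h1, h2, h3⟩ := hr n i.1
    have h4 := ENNReal.ofReal_le_ofReal (h2.trans (min_le_right _ _))
    rw [Prod.edist_eq]
    refine max_le ?_ ?_
    · refine (Metric.edist_le_ediam_of_mem hp.1 hq.1).trans (h3.trans (h4.trans ?_))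
      exact le_mul_of_one_le_left zero_le one_le_two
    · have a1 := Metric.mem_closedBall.1 hp.2
      have a2 := Metric.mem_closedBall.1 hq.2
      refine le_trans ?_ (mul_le_mul_right h4 2)
      rw [edist_dist, ← ENNReal.ofReal_ofNat 2, ← ENNReal.ofReal_mul (by norm_num)]
      refine ENNReal.ofReal_le_ofReal ?_
      linarith [dist_triangle_right p.2 q.2 (i.2 : Y)]
  · refine Eventually.of_forall fun n p hp => ?_
    obtain ⟨k, hk⟩ := mem_iUnion.1 (hV n hp.1)
    have := hF n k hp.2
    simp only [mem_iUnion, exists_prop] at this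
    obtain ⟨y, hy, hy'⟩ := this
    exact mem_iUnion.2 ⟨⟨k, ⟨y, hy⟩⟩, hk, hy'⟩

/-- The Hausdorff dimension of a product is at most the Hausdorff dimension of one factor plus the
packing dimension of the other. -/
theorem dimH_prod_le (A : Set X) (B : Set Y) : dimH (A ×ˢ B) ≤ dimH A + dimPacking B := by
  borelize X
  borelize (X × Y)
  refine ENNReal.le_of_forall_pos_le_add fun ε hε hfin => ?_
  obtain ⟨h1, h2⟩ := ENNReal.add_lt_top.1 hfin
  lift dimH A to ℝ≥0 using h1.ne with a ha
  lift dimPacking B to ℝ≥0 using h2.ne with b hb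
  have hA : μH[(a + ε / 2 : ℝ≥0)] A = 0 := by
    apply hausdorffMeasure_of_dimH_lt
    rw [← ha]
    exact_mod_cast lt_add_of_pos_right a (half_pos hε)
  have hB : packingMeasure (b + ε / 2) B ≠ ∞ := by
    apply packingMeasure_ne_top_of_dimPacking_lt
    rw [← hb]
    exact_mod_cast lt_add_of_pos_right b (half_pos hε)
  obtain ⟨U, hU, hsum⟩ : ∃ U : ℕ → Set Y, B ⊆ ⋃ j, U j ∧
      ∑' j, packingPremeasure (b + ε / 2) (U j) ≠ ∞ := by
    by_contra! h
    exact hB (by simp only [packingMeasure, iInf_eq_top]; exact h)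
  have hsub : A ×ˢ B ⊆ ⋃ j, A ×ˢ U j := by
    rw [← prod_iUnion]
    exact prod_mono subset_rfl hU
  refine (dimH_mono hsub).trans ?_
  rw [dimH_iUnion]
  refine iSup_le fun j => ?_
  have h0 := hausdorffMeasure_prod_eq_zero (U := U j) (t := b + ε / 2)
    (lt_of_lt_of_le (half_pos hε) le_add_self) hA
    (ne_top_of_le_ne_top hsum (ENNReal.le_tsum j))
  refine (dimH_le_of_hausdorffMeasure_ne_top (h0.trans_ne ENNReal.zero_ne_top)).trans ?_
  have : a + ε / 2 + (b + ε / 2) = a + b + ε := by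
    rw [add_add_add_comm, add_halves]
  rw [this]
  push_cast
  exact le_rfl

end Product

/-! ### Counting rationals by denominator -/

section Rationals

theorem rat_abs_num_le {r : ℚ} {M : ℕ} (h : |(r : ℝ)| ≤ M) : |r.num| ≤ M * r.den := by
  have hd : (0 : ℝ) < r.den := by exact_mod_cast r.den_pos
  have h1 : (r : ℝ) = r.num / r.den := by exact_mod_cast (Rat.num_div_den r).symm
  rw [h1, abs_div, abs_of_pos hd, div_le_iff₀ hd] at h
  exact_mod_cast h

theorem finite_setOf_rat_den_le (ξ R : ℝ) (B : ℕ) :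
    {r : ℚ | r.den ≤ B ∧ |ξ - r| ≤ R}.Finite := by
  obtain ⟨M, hM⟩ := exists_nat_ge (|ξ| + R)
  have hinj : Function.Injective fun r : ℚ => (r.num, r.den) := fun a b h =>
    Rat.ext (Prod.ext_iff.1 h).1 (Prod.ext_iff.1 h).2
  refine Set.Finite.of_finite_image ?_ hinj.injOn
  refine ((Set.finite_Icc (-(M * B : ℤ)) (M * B)).prod (Set.finite_Iic B)).subset ?_
  rintro _ ⟨r, ⟨hr1, hr2⟩, rfl⟩
  have h1 : |(r : ℝ)| ≤ M := by
    have : |(r : ℝ)| ≤ |ξ| + |ξ - r| := by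
      have := abs_sub_abs_le_abs_sub (r : ℝ) ξ
      rw [abs_sub_comm] at this
      linarith
    linarith
  have h2 := rat_abs_num_le h1
  have h3 : (M * r.den : ℤ) ≤ M * B := by exact_mod_cast Nat.mul_le_mul_left M hr1
  exact ⟨abs_le.1 (h2.trans h3), hr1⟩

theorem tsum_rat_le (M : ℕ) (f : ℕ → ℝ≥0∞) :
    ∑' r : {r : ℚ // |(r : ℝ)| ≤ M}, f r.1.den ≤ ∑' q : ℕ, (2 * M * q + 1 : ℕ) * f q := by
  let g : {r : ℚ // |(r : ℝ)| ≤ M} →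
      Σ q : ℕ, (Finset.Icc (-(M * q : ℤ)) (M * q)) := fun r =>
    ⟨r.1.den, ⟨r.1.num, Finset.mem_Icc.2 (abs_le.1 (rat_abs_num_le r.2))⟩⟩
  have hg : Function.Injective g := by
    intro a b h
    have h1 : a.1.den = b.1.den := congrArg Sigma.fst h
    have h2 : a.1.num = b.1.num :=
      congrArg (fun x : Σ q : ℕ, (Finset.Icc (-(M * q : ℤ)) (M * q)) => (x.2 : ℤ)) h
    exact Subtype.ext (Rat.ext h2 h1)
  have h1 := ENNReal.tsum_comp_le_tsum_of_injective hg (fun x => f x.1)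
  refine h1.trans (le_of_eq ?_)
  rw [ENNReal.tsum_sigma']
  refine tsum_congr fun q => ?_
  have : (Finset.Icc (-(M * q : ℤ)) (M * q)).card = 2 * M * q + 1 := by
    rw [Int.card_Icc]
    have : (M * q : ℤ) + 1 - -(M * q) = ((2 * M * q + 1 : ℕ) : ℤ) := by push_cast; ring
    rw [this, Int.toNat_natCast]
  simp only [ENNReal.tsum_const, ENat.card_eq_coe_fintype_card, Fintype.card_coe, this]
  simp

theorem tsum_rat_rpow_ne_top (M : ℕ) {s : ℝ} (hs : 2 < s) :
    ∑' r : {r : ℚ // |(r : ℝ)| ≤ M}, ENNReal.ofReal ((r.1.den : ℝ) ^ (-s)) ≠ ∞ := by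
  have hsum : Summable fun q : ℕ => (2 * M + 1) * (q : ℝ) ^ (1 - s) :=
    (Real.summable_nat_rpow.2 (by linarith)).mul_left _
  refine ne_top_of_le_ne_top hsum.tsum_ofReal_ne_top
    ((tsum_rat_le M fun q => ENNReal.ofReal ((q : ℝ) ^ (-s))).trans
      (ENNReal.tsum_le_tsum fun q => ?_))
  -- No rational has denominator 0; that extra term vanishes because `0 ^ (-s) = 0` for `Real.rpow`.
  rcases Nat.eq_zero_or_pos q with rfl | hq
  · rw [Nat.cast_zero, Real.zero_rpow (by linarith)]
    simp
  · have hq1 : (1 : ℝ) ≤ q := by exact_mod_cast hq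
    have hq0 : (0 : ℝ) < q := by linarith
    rw [← ENNReal.ofReal_natCast, ← ENNReal.ofReal_mul (by positivity)]
    refine ENNReal.ofReal_le_ofReal ?_
    have e1 : (q : ℝ) ^ (1 - s) = q * (q : ℝ) ^ (-s) := by
      rw [sub_eq_add_neg, Real.rpow_one_add' hq0.le (by linarith)]
    rw [e1]
    push_cast
    have h3 : 0 < (q : ℝ) ^ (-s) := by positivity
    have h4 : 2 * (M : ℝ) * q + 1 ≤ (2 * M + 1) * q := by linarith
    nlinarith

end Rationals

/-! ### Bounds for the irrationality exponent -/

section Exponent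

variable {ξ : ℝ}

theorem infinite_of_lt_irrationalityExponent {t : ℝ≥0} (h : (t : ℝ≥0∞) < irrationalityExponent ξ) :
    {r : ℚ | |ξ - (r : ℝ)| ≤ (r.den : ℝ) ^ (-(t : ℝ))}.Infinite := by
  obtain ⟨t', h'⟩ := lt_iSup_iff.1 h
  obtain ⟨hinf, hlt⟩ := lt_iSup_iff.1 h'
  refine hinf.mono fun r (hr : |ξ - (r : ℝ)| ≤ (r.den : ℝ) ^ (-(t' : ℝ))) => le_trans hr ?_
  have hd : (1 : ℝ) ≤ r.den := by exact_mod_cast r.den_pos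
  have : (t : ℝ) < t' := by exact_mod_cast hlt
  exact Real.rpow_le_rpow_of_exponent_le hd (by linarith)

theorem le_irrationalityExponent {t : ℝ≥0}
    (h : {r : ℚ | |ξ - (r : ℝ)| ≤ (r.den : ℝ) ^ (-(t : ℝ))}.Infinite) :
    (t : ℝ≥0∞) ≤ irrationalityExponent ξ :=
  le_iSup₂_of_le (f := fun (t : ℝ≥0)
    (_ : {r : ℚ | |ξ - (r : ℝ)| ≤ (r.den : ℝ) ^ (-(t : ℝ))}.Infinite) => (t : ℝ≥0∞)) t h le_rfl

/-- The constant c is harmless: for t > s, q^(t-s) eventually exceeds 1/c, leaving only finitely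
many rationals of bounded denominator. -/
theorem irrationalityExponent_le {s : ℝ≥0} {c : ℝ} (hc : 0 < c) {B : ℕ}
    (h : ∀ r : ℚ, B ≤ r.den → c * (r.den : ℝ) ^ (-(s : ℝ)) ≤ |ξ - r|) :
    irrationalityExponent ξ ≤ s := by
  refine iSup₂_le fun t ht => ?_
  by_contra hst
  push Not at hst
  have hst' : (s : ℝ) < t := by exact_mod_cast hst
  have hlim := (tendsto_rpow_atTop (sub_pos.2 hst')).comp tendsto_natCast_atTop_atTop
  obtain ⟨B', hB'⟩ := (hlim.eventually_gt_atTop c⁻¹).exists_forall_of_atTop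
  refine ht ((finite_setOf_rat_den_le ξ 1 (max B B')).subset fun r hr => ?_)
  have hd : (1 : ℝ) ≤ r.den := by exact_mod_cast r.den_pos
  have hd0 : (0 : ℝ) < r.den := by linarith
  refine ⟨?_, le_trans hr (Real.rpow_le_one_of_one_le_of_nonpos hd (by simp))⟩
  by_contra! hlt
  have h1 := h r ((le_max_left _ _).trans hlt.le)
  have h2 := hB' r.den ((le_max_right _ _).trans hlt.le)
  simp only [Function.comp] at h2
  have h3 := h1.trans hr
  have h4 : (r.den : ℝ) ^ (-(s : ℝ)) = (r.den : ℝ) ^ ((t : ℝ) - s) * (r.den : ℝ) ^ (-(t : ℝ)) := by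
    rw [← Real.rpow_add hd0]; ring_nf
  have h5 : 0 < (r.den : ℝ) ^ (-(t : ℝ)) := Real.rpow_pos_of_pos hd0 _
  rw [h4, ← mul_assoc] at h3
  have h6 : 1 < c * (r.den : ℝ) ^ ((t : ℝ) - s) := by
    rwa [inv_lt_iff_one_lt_mul₀' hc] at h2
  nlinarith

end Exponent

/-! ### The upper half of the Jarník–Besicovitch theorem -/

section JarnikBesicovitch

theorem ediam_closedBall_real (x r : ℝ) :
    Metric.ediam (Metric.closedBall x r) = ENNReal.ofReal (2 * r) := by
  rw [Real.closedBall_eq_Icc, Real.ediam_Icc]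
  congr 1
  ring

/-- In a bounded window, the balls of radius q^(-t) about rationals of denominator q > n cover the
set for every n. There are O(q) of them for each q, so their d-sums converge once dt > 2. -/
theorem dimH_setOf_infinite_le {t : ℝ≥0} (ht : 0 < t) :
    dimH {ξ : ℝ | {r : ℚ | |ξ - (r : ℝ)| ≤ (r.den : ℝ) ^ (-(t : ℝ))}.Infinite} ≤ 2 / t := by
  set S := {ξ : ℝ | {r : ℚ | |ξ - (r : ℝ)| ≤ (r.den : ℝ) ^ (-(t : ℝ))}.Infinite}
  have hS : S ⊆ ⋃ M : ℕ, S ∩ Metric.closedBall 0 M := by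
    rw [← inter_iUnion, Metric.iUnion_closedBall_nat, inter_univ]
  have ht' : (0 : ℝ) < t := ht
  refine (dimH_mono hS).trans ?_
  rw [dimH_iUnion]
  refine iSup_le fun M => ?_
  refine le_of_forall_gt_imp_ge_of_dense fun d' hd' => ?_
  rcases eq_or_ne d' ∞ with rfl | hd't
  · exact le_top
  lift d' to ℝ≥0 using hd't with d
  have htd : (2 : ℝ) < d * t := by
    rw [ENNReal.div_lt_iff (by simp [ht.ne']) (by simp)] at hd'
    exact_mod_cast hd'
  have hd0 : (0 : ℝ) < d := by
    by_contra! h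
    nlinarith
  refine dimH_le_of_hausdorffMeasure_ne_top (ne_top_of_le_ne_top ?_
    (Measure.hausdorffMeasure_le_liminf_tsum (l := atTop) (d : ℝ) (S ∩ Metric.closedBall 0 M)
      (ι := fun n => {r : {r : ℚ // |(r : ℝ)| ≤ (M + 1 : ℕ)} // n + 1 ≤ r.1.den})
      (fun n : ℕ => ENNReal.ofReal (2 * ((n + 1 : ℕ) : ℝ) ^ (-(t : ℝ)))) ?_
      (fun n r => Metric.closedBall (r.1.1 : ℝ) ((r.1.1.den : ℝ) ^ (-(t : ℝ)))) ?_ ?_))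
  · set f : ℕ → ℝ≥0∞ := fun q => ENNReal.ofReal ((2 * (q : ℝ) ^ (-(t : ℝ))) ^ (d : ℝ))
    have hfin : ∑' r : {r : ℚ // |(r : ℝ)| ≤ (M + 1 : ℕ)}, f r.1.den ≠ ∞ := by
      have hf : ∀ q : ℕ, f q = ENNReal.ofReal (2 ^ (d : ℝ)) *
          ENNReal.ofReal ((q : ℝ) ^ (-((t : ℝ) * d))) := fun q => by
        simp only [f]
        rw [Real.mul_rpow (by norm_num) (by positivity), ← Real.rpow_mul (by positivity),
          ENNReal.ofReal_mul (by positivity), neg_mul]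
      simp only [hf, ENNReal.tsum_mul_left]
      exact ENNReal.mul_ne_top ENNReal.ofReal_ne_top
        (tsum_rat_rpow_ne_top (M + 1) (by rwa [mul_comm]))
    refine ne_top_of_le_ne_top hfin ?_
    refine liminf_le_of_le (by isBoundedDefault) fun b hb => ?_
    obtain ⟨n, hn⟩ := hb.exists
    refine hn.trans (le_trans ?_ (ENNReal.tsum_comp_le_tsum_of_injective
      (Subtype.val_injective (p := fun r : {r : ℚ // |(r : ℝ)| ≤ (M + 1 : ℕ)} => n + 1 ≤ r.1.den))
      fun r => f r.1.den))
    refine ENNReal.tsum_le_tsum fun r => ?_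
    rw [ediam_closedBall_real, ENNReal.ofReal_rpow_of_nonneg (by positivity) hd0.le]
  · have h1 : Tendsto (fun n : ℕ => 2 * ((n + 1 : ℕ) : ℝ) ^ (-(t : ℝ))) atTop (𝓝 (2 * 0)) :=
      (((tendsto_rpow_neg_atTop ht').comp tendsto_natCast_atTop_atTop).comp
        (tendsto_add_atTop_nat 1)).const_mul 2
    simpa using ENNReal.tendsto_ofReal h1
  · refine Eventually.of_forall fun n r => ?_
    rw [ediam_closedBall_real]
    have h1 : ((n + 1 : ℕ) : ℝ) ≤ r.1.1.den := by exact_mod_cast r.2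
    exact ENNReal.ofReal_le_ofReal (mul_le_mul_of_nonneg_left
      (Real.rpow_le_rpow_of_nonpos (by positivity) h1 (by linarith)) (by norm_num))
  · refine Eventually.of_forall fun n ξ hξ => ?_
    obtain ⟨r, hr, hr'⟩ := (Set.Infinite.sdiff hξ.1 (finite_setOf_rat_den_le ξ 1 n)).nonempty
    have hd : (1 : ℝ) ≤ r.den := by exact_mod_cast r.den_pos
    have h1 : |ξ - r| ≤ 1 :=
      le_trans hr (Real.rpow_le_one_of_one_le_of_nonpos hd (by simp))
    have h2 : ¬ r.den ≤ n := fun h => hr' ⟨h, h1⟩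
    have h3 : |ξ| ≤ M := by simpa using hξ.2
    have h4 : |(r : ℝ)| ≤ (M + 1 : ℕ) := by
      have := abs_sub_abs_le_abs_sub (r : ℝ) ξ
      rw [abs_sub_comm] at this
      push_cast
      linarith
    exact mem_iUnion.2 ⟨⟨⟨r, h4⟩, by simp only; omega⟩, by
      rw [Metric.mem_closedBall, Real.dist_eq]; exact hr⟩

theorem dimH_W_le {l m : ℝ≥0∞} (hl : l ≠ 0) : dimH (W l m) ≤ 2 / l := by
  by_contra! h
  have hD0 : dimH (W l m) ≠ 0 := (zero_le.trans_lt h).ne'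
  have hDt : dimH (W l m) ≠ ∞ := Real.dimH_ne_top _
  rw [ENNReal.div_lt_iff (Or.inl hl) (Or.inr (by simp)), mul_comm,
    ← ENNReal.div_lt_iff (Or.inl hD0) (Or.inl hDt)] at h
  obtain ⟨t, ht1, ht2⟩ := ENNReal.lt_iff_exists_nnreal_btwn.1 h
  have ht0 : (0 : ℝ≥0∞) < t := zero_le.trans_lt ht1
  have h1 : dimH (W l m) ≤ 2 / t := (dimH_mono fun ξ hξ =>
    infinite_of_lt_irrationalityExponent (ht2.trans_le hξ.1)).trans
      (dimH_setOf_infinite_le (by exact_mod_cast ht0))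
  rw [ENNReal.div_lt_iff (Or.inl hD0) (Or.inl hDt)] at ht1
  rw [ENNReal.le_div_iff_mul_le (Or.inl ht0.ne') (Or.inl (by simp)), mul_comm] at h1
  exact absurd ht1 (not_lt.2 h1)

end JarnikBesicovitch

/-! ### Almost every point has finitely many resonances -/

section Generic

/-- The pairs of rationals `(r, r')` such that `r` is close to `v` and `w + r` is very close
to `r'`. -/
def resonances (w v : ℝ) : Set (ℚ × ℚ) :=
  {p | |v - p.1| ≤ 1 / (p.1.den : ℝ) ^ 2 ∧ p.1.den ≤ p.2.den ^ 2 ∧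
    |w + p.1 - p.2| < 1 / (p.2.den : ℝ) ^ 3}

theorem abs_le_of_abs_sub_le_one {a b M : ℝ} (h : |a - b| ≤ 1) (ha : |a| ≤ M) : |b| ≤ M + 1 := by
  have := abs_sub_abs_le_abs_sub b a
  rw [abs_sub_comm] at this
  linarith

theorem one_div_den_pow_le_one (r : ℚ) (k : ℕ) : 1 / (r.den : ℝ) ^ k ≤ 1 := by
  have hd : (1 : ℝ) ≤ r.den := by exact_mod_cast r.den_pos
  exact div_le_one_of_le₀ (one_le_pow₀ hd) (by positivity)

theorem ae_finite_resonances_window (K : ℕ) :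
    ∀ᵐ p : ℝ × ℝ, {q : {r : ℚ // |(r : ℝ)| ≤ K} × {r : ℚ // |(r : ℝ)| ≤ K} |
      ((q.1 : ℚ), (q.2 : ℚ)) ∈ resonances p.1 p.2}.Finite := by
  let s : {r : ℚ // |(r : ℝ)| ≤ K} × {r : ℚ // |(r : ℝ)| ≤ K} → Set (ℝ × ℝ) := fun q =>
    {p | ((q.1 : ℚ), (q.2 : ℚ)) ∈ resonances p.1 p.2}
  have hs : ∑' q, volume (s q) ≠ ∞ := by
    -- A resonance has measure at most 4 q^(-2) q'^(-3). Since q ≤ q'^2, a factor q'^(-1/2) can be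
    -- traded for q^(-1/4); both resulting exponents, 9/4 and 5/2, exceed 2, as convergence over
    -- rationals requires.
    have hle : ∀ q, volume (s q) ≤ ENNReal.ofReal 4 *
        ENNReal.ofReal ((q.1.1.den : ℝ) ^ (-(9 / 4) : ℝ)) *
          ENNReal.ofReal ((q.2.1.den : ℝ) ^ (-(5 / 2) : ℝ)) := by
      rintro ⟨⟨r, hr⟩, ⟨r', hr'⟩⟩
      by_cases hden : r.den ≤ r'.den ^ 2
      · have hsub : s (⟨r, hr⟩, ⟨r', hr'⟩) ⊆
            Metric.ball ((r' : ℝ) - r) (1 / (r'.den : ℝ) ^ 3) ×ˢ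
              Metric.closedBall (r : ℝ) (1 / (r.den : ℝ) ^ 2) := by
          rintro ⟨w, v⟩ ⟨h1, -, h3⟩
          refine ⟨?_, ?_⟩
          · rw [Metric.mem_ball, Real.dist_eq]
            convert h3 using 2
            ring
          · rw [Metric.mem_closedBall, Real.dist_eq]
            exact h1
        refine (measure_mono hsub).trans ?_
        rw [Measure.volume_eq_prod, Measure.prod_prod, Real.volume_ball, Real.volume_closedBall,
          ← ENNReal.ofReal_mul (by positivity), ← ENNReal.ofReal_mul (by positivity),
          ← ENNReal.ofReal_mul (by positivity)]
        refine ENNReal.ofReal_le_ofReal ?_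
        dsimp only
        have hq : (0 : ℝ) < r.den := by exact_mod_cast r.den_pos
        have hq' : (0 : ℝ) < r'.den := by exact_mod_cast r'.den_pos
        have hd : (r.den : ℝ) ≤ (r'.den : ℝ) ^ (2 : ℝ) := by
          rw [Real.rpow_ofNat]; exact_mod_cast hden
        have e1 : 1 / (r'.den : ℝ) ^ 3 = (r'.den : ℝ) ^ (-(5 / 2) : ℝ) *
            ((r'.den : ℝ) ^ (2 : ℝ)) ^ (-(1 / 4) : ℝ) := by
          rw [← Real.rpow_mul hq'.le, ← Real.rpow_add hq', one_div, ← Real.rpow_natCast,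
            ← Real.rpow_neg hq'.le]
          norm_num
        have e2 : (r.den : ℝ) ^ (-(9 / 4) : ℝ) = 1 / (r.den : ℝ) ^ 2 *
            (r.den : ℝ) ^ (-(1 / 4) : ℝ) := by
          rw [one_div, ← Real.rpow_natCast, ← Real.rpow_neg hq.le, ← Real.rpow_add hq]
          norm_num
        have e3 : ((r'.den : ℝ) ^ (2 : ℝ)) ^ (-(1 / 4) : ℝ) ≤ (r.den : ℝ) ^ (-(1 / 4) : ℝ) :=
          Real.rpow_le_rpow_of_nonpos hq hd (by norm_num)
        rw [e1, e2]
        have h5 : 0 < (r'.den : ℝ) ^ (-(5 / 2) : ℝ) := by positivity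
        have h6 : 0 < 1 / (r.den : ℝ) ^ 2 := by positivity
        have := mul_le_mul_of_nonneg_left e3 (mul_pos h5 h6).le
        nlinarith
      · have : s (⟨r, hr⟩, ⟨r', hr'⟩) = ∅ := by
          ext p
          simp only [mem_empty_iff_false, iff_false]
          exact fun h => hden h.2.1
        rw [this]
        simp
    refine ne_top_of_le_ne_top ?_ (ENNReal.tsum_le_tsum hle)
    rw [ENNReal.tsum_prod']
    simp only [ENNReal.tsum_mul_left, ENNReal.tsum_mul_right]
    exact ENNReal.mul_ne_top (ENNReal.mul_ne_top ENNReal.ofReal_ne_top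
      (tsum_rat_rpow_ne_top K (by norm_num))) (tsum_rat_rpow_ne_top K (by norm_num))
  exact ae_finite_setOfPred_mem hs

theorem ae_finite_resonances : ∀ᵐ w : ℝ, ∀ᵐ v : ℝ, (resonances w v).Finite := by
  have h : ∀ᵐ p : ℝ × ℝ, (resonances p.1 p.2).Finite := by
    filter_upwards [ae_all_iff.2 ae_finite_resonances_window] with p hp
    obtain ⟨M, hM⟩ := exists_nat_ge (max |p.1| |p.2|)
    have h1 : |p.1| ≤ M := (le_max_left _ _).trans hM
    have h2 : |p.2| ≤ M := (le_max_right _ _).trans hM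
    refine ((hp (2 * M + 2)).image fun q => ((q.1 : ℚ), (q.2 : ℚ))).subset ?_
    rintro ⟨r, r'⟩ hr
    have h3 : |(r : ℝ)| ≤ M + 1 :=
      abs_le_of_abs_sub_le_one (hr.1.trans (one_div_den_pow_le_one _ _)) h2
    have h4 : |(r' : ℝ)| ≤ (M + (M + 1)) + 1 :=
      abs_le_of_abs_sub_le_one (hr.2.2.le.trans (one_div_den_pow_le_one _ _))
        ((abs_add_le _ _).trans (add_le_add h1 h3))
    exact ⟨(⟨r, by push_cast; linarith⟩, ⟨r', by push_cast; linarith⟩), hr, rfl⟩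
  rw [Measure.volume_eq_prod] at h
  exact Measure.ae_ae_of_ae_prod h

variable {ι : Type*} [Fintype ι]

/-- The numbers `u` for which `z i - u` is irrational and only finitely many resonances occur. -/
def genericSet (z : ι → ℝ) : Set ℝ :=
  {u | ∀ i, Irrational (z i - u) ∧ ∀ j, i ≠ j → (resonances (z j - z i) (z i - u)).Finite}

/-- The exceptional set need not be measurable, so a measurable null superset is pulled back
instead. -/
theorem ae_comp_of_surjective {f : (ι → ℝ) →ₗ[ℝ] ℝ} (hf : Function.Surjective f) {p : ℝ → Prop}
    (hp : ∀ᵐ y, p y) : ∀ᵐ x, p (f x) := by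
  obtain ⟨t, ht, htm, ht0⟩ := exists_measurable_superset_of_null (ae_iff.1 hp)
  have h1 : ∀ᵐ y, y ∈ tᶜ := by rw [ae_iff]; simpa using ht0
  filter_upwards [(ae_comp_linearMap_mem_iff f volume volume hf htm.compl).2 h1] with x hx
  by_contra h
  exact hx (ht h)

theorem ae_irrational : ∀ᵐ x : ℝ, Irrational x :=
  (countable_range ((↑) : ℚ → ℝ)).ae_notMem volume

theorem ae_mem_genericSet : ∀ᵐ z : ι → ℝ, ∀ᵐ u : ℝ, u ∈ genericSet z := by
  have h : ∀ i j : ι, i ≠ j → ∀ᵐ z : ι → ℝ, ∀ᵐ v : ℝ, (resonances (z j - z i) v).Finite := by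
    classical
    intro i j hij
    refine ae_comp_of_surjective
      (f := (LinearMap.proj j : (ι → ℝ) →ₗ[ℝ] ℝ) - (LinearMap.proj i : (ι → ℝ) →ₗ[ℝ] ℝ))
      (fun y => ⟨Pi.single j y, ?_⟩) ae_finite_resonances
    simp [hij]
  have h' : ∀ᵐ z : ι → ℝ, ∀ i j : ι, i ≠ j → ∀ᵐ v : ℝ, (resonances (z j - z i) v).Finite := by
    simpa only [ae_all_iff] using h
  filter_upwards [h'] with z hz
  have hsub : ∀ i, ∀ {p : ℝ → Prop}, (∀ᵐ v, p v) → ∀ᵐ u, p (z i - u) := fun i p hp =>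
    (Measure.measurePreserving_sub_left volume (z i)).quasiMeasurePreserving.ae hp
  refine ae_all_iff.2 fun i => (hsub i ae_irrational).and (ae_all_iff.2 fun j => ?_)
  by_cases hij : i = j
  · exact Eventually.of_forall fun _ h => absurd hij h
  · filter_upwards [hsub i (hz i j hij)] with u hu _ using hu

end Generic

/-! ### Measure of neighbourhoods of rationals in a short interval -/

section Selection

theorem rat_den_pos (r : ℚ) : (0 : ℝ) < r.den := by exact_mod_cast r.den_pos

theorem one_div_den_mul_den_le_abs_sub {r r' : ℚ} (h : r ≠ r') :
    1 / ((r.den : ℝ) * r'.den) ≤ |(r : ℝ) - r'| := by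
  have h1 := rat_den_pos r
  have h2 := rat_den_pos r'
  have e1 : (r : ℝ) = r.num / r.den := by exact_mod_cast (Rat.num_div_den r).symm
  have e2 : (r' : ℝ) = r'.num / r'.den := by exact_mod_cast (Rat.num_div_den r').symm
  have hne : r.num * r'.den - r.den * r'.num ≠ 0 := by
    intro h0
    apply h
    have h3 : (r : ℝ) = r' := by
      rw [e1, e2, div_eq_div_iff h1.ne' h2.ne']
      have : (r.num * r'.den : ℤ) = r'.num * r.den := by linarith
      exact_mod_cast this
    exact_mod_cast h3
  rw [e1, e2, div_sub_div _ _ h1.ne' h2.ne', abs_div, abs_of_pos (mul_pos h1 h2)]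
  refine div_le_div_of_nonneg_right ?_ (mul_pos h1 h2).le
  exact_mod_cast Int.one_le_abs hne

theorem tsum_one_div_sq_tail_le {q₀ : ℕ} (hq : 1 ≤ q₀) :
    ∑' q : ℕ, (if q₀ ≤ q then ENNReal.ofReal (1 / (q : ℝ) ^ 2) else 0) ≤
      ENNReal.ofReal (2 / q₀) := by
  refine ENNReal.tsum_le_of_sum_range_le fun n => ?_
  rw [← Finset.sum_filter, ← ENNReal.ofReal_sum_of_nonneg fun _ _ => by positivity]
  refine ENNReal.ofReal_le_ofReal ?_
  have h1 := sum_Ioo_inv_sq_le (α := ℝ) (q₀ - 1) n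
  have h2 : ((q₀ - 1 : ℕ) : ℝ) + 1 = q₀ := by
    rw [Nat.cast_sub hq]; simp
  rw [h2] at h1
  refine le_trans (le_of_eq ?_) h1
  refine Finset.sum_congr ?_ fun _ _ => one_div _
  ext q
  simp only [Finset.mem_filter, Finset.mem_range, Finset.mem_Ioo]
  omega

theorem card_Icc_ceil_floor_le {x y : ℝ} (h : x ≤ y + 1) :
    ((Finset.Icc ⌈x⌉ ⌊y⌋).card : ℝ) ≤ y - x + 1 := by
  rw [Int.card_Icc]
  rcases le_total 0 (⌊y⌋ + 1 - ⌈x⌉) with h0 | h0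
  · have h1 : (((⌊y⌋ + 1 - ⌈x⌉).toNat : ℤ) : ℝ) = ((⌊y⌋ + 1 - ⌈x⌉ : ℤ) : ℝ) := by
      rw [Int.toNat_of_nonneg h0]
    rw [Int.cast_natCast] at h1
    rw [h1]
    push_cast
    linarith [Int.floor_le y, Int.le_ceil x]
  · rw [Int.toNat_of_nonpos h0]
    simp only [Nat.cast_zero]
    linarith

/-- Only one rational matters: two of them would be at most 2l apart, while distinct rationals with
such small denominators differ by more than 8l. -/
theorem volume_near_small_rationals_le {a l c : ℝ} (hl : 0 < l) (hc : 0 < c) (hc' : c ≤ 1 / 16) :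
    volume {t : ℝ | t ∈ Icc a (a + l) ∧ ∃ r : ℚ, (r.den : ℝ) ^ 2 * (8 * l) < 1 ∧
      1 / (r.den : ℝ) ^ 3 ≤ 8 * l ∧ |t - r| < c / (r.den : ℝ) ^ 3} ≤ ENNReal.ofReal (16 * c * l) := by
  set S := {t : ℝ | t ∈ Icc a (a + l) ∧ ∃ r : ℚ, (r.den : ℝ) ^ 2 * (8 * l) < 1 ∧
      1 / (r.den : ℝ) ^ 3 ≤ 8 * l ∧ |t - r| < c / (r.den : ℝ) ^ 3}
  have hball : ∀ {t : ℝ} {r : ℚ}, 1 / (r.den : ℝ) ^ 3 ≤ 8 * l → |t - r| < c / (r.den : ℝ) ^ 3 →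
      |t - r| < 8 * c * l := by
    intro t r h1 h2
    rw [div_eq_mul_one_div] at h2
    nlinarith [mul_le_mul_of_nonneg_left h1 hc.le]
  rcases S.eq_empty_or_nonempty with h0 | ⟨t₀, ht₀, r₀, h₁, h₂, h₃⟩
  · rw [h0]
    simp
  · have hsub : S ⊆ Metric.ball (r₀ : ℝ) (8 * c * l) := by
      rintro t ⟨ht, r, h1, h2, h3⟩
      have hr : r = r₀ := by
        by_contra hne
        have g1 := one_div_den_mul_den_le_abs_sub hne
        have g2 := hball h2 h3
        have g3 := hball h₂ h₃
        have g4 : |t - t₀| ≤ l := by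
          rw [abs_le]
          constructor <;> linarith [ht.1, ht.2, ht₀.1, ht₀.2]
        have g5 : |(r : ℝ) - r₀| ≤ 2 * l := by
          have : (r : ℝ) - r₀ = -(t - r) + (t - t₀) + (t₀ - r₀) := by ring
          rw [this]
          refine (abs_add_three _ _ _).trans ?_
          rw [abs_neg]
          nlinarith
        have d1 := rat_den_pos r
        have d2 := rat_den_pos r₀
        have g6 := g1.trans g5
        rw [div_le_iff₀ (mul_pos d1 d2)] at g6
        have g7 : ((r.den : ℝ) ^ 2 * (8 * l)) * ((r₀.den : ℝ) ^ 2 * (8 * l)) < 1 := by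
          have : 0 < (r.den : ℝ) ^ 2 * (8 * l) := by positivity
          have : 0 < (r₀.den : ℝ) ^ 2 * (8 * l) := by positivity
          nlinarith
        have g8 : ((r.den : ℝ) ^ 2 * (8 * l)) * ((r₀.den : ℝ) ^ 2 * (8 * l)) =
            16 * (2 * l * (r.den * r₀.den)) ^ 2 := by ring
        rw [g8] at g7
        nlinarith
      rw [Metric.mem_ball, Real.dist_eq, ← hr]
      exact hball h2 h3
    refine (measure_mono hsub).trans ?_
    rw [Real.volume_ball]
    refine ENNReal.ofReal_le_ofReal (le_of_eq (by ring))

/-- Let q₀ be the least admitted denominator, so 1/q₀² ≤ 8l. At most ql + 3 numerators matter for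
each q, and summing 2c(l + 3/q)/q² over q ≥ q₀ gives at most 4cl + 96cl. -/
theorem volume_near_large_rationals_le {a l c : ℝ} (hl : 0 < l) (hc : 0 < c) (hc' : c ≤ 1 / 16) :
    volume {t : ℝ | t ∈ Icc a (a + l) ∧ ∃ r : ℚ, 1 ≤ (r.den : ℝ) ^ 2 * (8 * l) ∧
      |t - r| < c / (r.den : ℝ) ^ 3} ≤ ENNReal.ofReal (100 * c * l) := by
  classical
  have hex : ∃ q : ℕ, 1 ≤ q ∧ 1 ≤ (q : ℝ) ^ 2 * (8 * l) := by
    obtain ⟨q, hq⟩ := exists_nat_ge (max 1 (1 / (8 * l)))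
    have h1 : (1 : ℝ) ≤ q := (le_max_left _ _).trans hq
    have h2 := (le_max_right _ _).trans hq
    rw [div_le_iff₀ (by positivity)] at h2
    refine ⟨q, by exact_mod_cast h1, h2.trans ?_⟩
    exact mul_le_mul_of_nonneg_right (by nlinarith) (by positivity)
  obtain ⟨hq1, hq2⟩ := Nat.find_spec hex
  have hmin : ∀ q : ℕ, 1 ≤ q → 1 ≤ (q : ℝ) ^ 2 * (8 * l) → Nat.find hex ≤ q :=
    fun q h1 h2 => Nat.find_min' hex ⟨h1, h2⟩
  generalize Nat.find hex = q₀ at hq1 hq2 hmin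
  have hq0 : (0 : ℝ) < q₀ := by exact_mod_cast hq1
  let F : ℕ → Finset ℤ := fun q => Finset.Icc ⌈q * a - 1⌉ ⌊q * (a + l) + 1⌋
  let B : ℕ → Set ℝ := fun q =>
    if q₀ ≤ q then ⋃ p ∈ F q, Metric.ball ((p : ℝ) / q) (c / (q : ℝ) ^ 3) else ∅
  have hsub : {t : ℝ | t ∈ Icc a (a + l) ∧ ∃ r : ℚ, 1 ≤ (r.den : ℝ) ^ 2 * (8 * l) ∧
      |t - r| < c / (r.den : ℝ) ^ 3} ⊆ ⋃ q, B q := by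
    rintro t ⟨ht, r, h1, h2⟩
    have hd := rat_den_pos r
    have hd1 : (1 : ℝ) ≤ r.den := by exact_mod_cast r.den_pos
    refine mem_iUnion.2 ⟨r.den, ?_⟩
    simp only [B, if_pos (hmin r.den r.den_pos h1), mem_iUnion, exists_prop]
    have e1 : (r : ℝ) = r.num / r.den := by exact_mod_cast (Rat.num_div_den r).symm
    refine ⟨r.num, ?_, ?_⟩
    · have h3 : |t - r| < 1 / r.den := by
        refine h2.trans_le ?_
        rw [div_le_div_iff₀ (by positivity) hd]
        have : (r.den : ℝ) ≤ r.den ^ 3 := le_self_pow₀ hd1 (by norm_num)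
        nlinarith
      rw [e1, abs_lt, lt_sub_iff_add_lt, sub_lt_iff_lt_add] at h3
      have h4 : (r.num : ℝ) = r.den * (r.num / r.den) := by field_simp
      have h5 : (r.den : ℝ) * (1 / r.den) = 1 := by field_simp
      have h6 := mul_lt_mul_of_pos_left h3.1 hd
      have h7 := mul_lt_mul_of_pos_left h3.2 hd
      have h8 := mul_le_mul_of_nonneg_left ht.1 hd.le
      have h9 := mul_le_mul_of_nonneg_left ht.2 hd.le
      rw [mul_add] at h6 h7
      rw [mul_neg] at h6
      refine Finset.mem_Icc.2 ⟨Int.ceil_le.2 (by linarith), Int.le_floor.2 (by linarith)⟩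
    · rw [Metric.mem_ball, Real.dist_eq, ← e1]
      exact h2
  have hB : ∀ q, volume (B q) ≤ ENNReal.ofReal (2 * c * (l + 3 / q₀)) *
      (if q₀ ≤ q then ENNReal.ofReal (1 / (q : ℝ) ^ 2) else 0) := by
    intro q
    by_cases hq : q₀ ≤ q
    · simp only [B, if_pos hq]
      have hqr : (q₀ : ℝ) ≤ q := by exact_mod_cast hq
      have hqp : (0 : ℝ) < q := hq0.trans_le hqr
      refine (measure_biUnion_finset_le _ _).trans ?_
      simp only [Real.volume_ball, Finset.sum_const, nsmul_eq_mul]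
      rw [← ENNReal.ofReal_natCast, ← ENNReal.ofReal_mul (by positivity),
        ← ENNReal.ofReal_mul (by positivity)]
      refine ENNReal.ofReal_le_ofReal ?_
      have h1 : ((F q).card : ℝ) ≤ q * l + 3 := by
        refine (card_Icc_ceil_floor_le (by nlinarith)).trans (le_of_eq (by ring))
      have h2 : 3 / (q : ℝ) ≤ 3 / q₀ := div_le_div_of_nonneg_left (by norm_num) hq0 hqr
      calc ((F q).card : ℝ) * (2 * (c / (q : ℝ) ^ 3))
          ≤ (q * l + 3) * (2 * (c / (q : ℝ) ^ 3)) :=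
            mul_le_mul_of_nonneg_right h1 (by positivity)
        _ = 2 * c * (l + 3 / q) * (1 / (q : ℝ) ^ 2) := by field_simp
        _ ≤ 2 * c * (l + 3 / q₀) * (1 / (q : ℝ) ^ 2) := by gcongr
    · simp [B, if_neg hq]
  refine (measure_mono hsub).trans ((measure_iUnion_le _).trans
    ((ENNReal.tsum_le_tsum hB).trans ?_))
  rw [ENNReal.tsum_mul_left]
  refine (mul_le_mul_right (tsum_one_div_sq_tail_le hq1) _).trans ?_
  rw [← ENNReal.ofReal_mul (by positivity)]
  refine ENNReal.ofReal_le_ofReal ?_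
  have h1 : (1 : ℝ) / q₀ ≤ 1 := div_le_one_of_le₀ (by exact_mod_cast hq1) hq0.le
  have h2 : (1 : ℝ) / q₀ ^ 2 ≤ 8 * l := by
    rw [div_le_iff₀ (by positivity)]
    linarith
  have e : 2 * c * (l + 3 / q₀) * (2 / q₀) = 4 * c * l * (1 / q₀) + 12 * c * (1 / q₀ ^ 2) := by
    field_simp
    ring
  rw [e]
  have h3 : 0 < c * l := by positivity
  nlinarith [mul_le_mul_of_nonneg_left h2 hc.le, mul_le_mul_of_nonneg_left h1 h3.le]

theorem volume_near_rationals_le {a l c : ℝ} (hl : 0 < l) (hc : 0 < c) (hc' : c ≤ 1 / 16) :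
    volume {t : ℝ | t ∈ Icc a (a + l) ∧ ∃ r : ℚ,
      1 / (r.den : ℝ) ^ 3 ≤ 8 * l ∧ |t - r| < c / (r.den : ℝ) ^ 3} ≤
      ENNReal.ofReal (116 * c * l) := by
  refine (measure_mono ?_).trans ((measure_union_le _ _).trans ((add_le_add
    (volume_near_small_rationals_le (a := a) hl hc hc')
    (volume_near_large_rationals_le (a := a) hl hc hc')).trans (le_of_eq ?_)))
  · rintro t ⟨ht, r, h1, h2⟩
    rcases lt_or_ge ((r.den : ℝ) ^ 2 * (8 * l)) 1 with h | h
    · exact Or.inl ⟨ht, r, h, h1, h2⟩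
    · exact Or.inr ⟨ht, r, h, h2⟩
  · rw [← ENNReal.ofReal_add (by positivity) (by positivity)]
    ring_nf

end Selection

/-! ### The nested interval construction -/

section Construction

variable {ι : Type*} [Fintype ι]

/-- Near `z i - r` one finds generic points `u` such that no `z j - u` is abnormally close to a
rational with large denominator, apart from `z i - u` and `r`. -/
theorem exists_generic_point (z : ι → ℝ) {G : Set ℝ} (hG : ∀ᵐ u : ℝ, u ∈ G) (i : ι) (r : ℚ)
    {ρ c : ℝ} (hρ : 0 < ρ) (hc : 0 < c) (hcN : 200 * (Fintype.card ι + 1) * c ≤ 1)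
    (hr : ∀ (j : ι) (r' : ℚ), r.den ≤ r'.den ^ 2 → (j = i → r' ≠ r) →
      1 / (r'.den : ℝ) ^ 3 ≤ |z j - z i + r - r'|) :
    ∃ u ∈ G, ρ / 2 < z i - u - r ∧ z i - u - r < ρ ∧
      ∀ (j : ι) (r' : ℚ), r.den ≤ r'.den ^ 2 → (j = i → r' ≠ r) →
        c / (r'.den : ℝ) ^ 3 ≤ |z j - u - r'| := by
  set J := Ioo (z i - r - ρ) (z i - r - ρ / 2)
  let B : ι → Set ℝ := fun j => {u | u ∈ J ∧ ∃ r' : ℚ, 1 / (r'.den : ℝ) ^ 3 ≤ 8 * (ρ / 2) ∧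
    |z j - u - r'| < c / (r'.den : ℝ) ^ 3}
  have hN : (0 : ℝ) ≤ Fintype.card ι := Nat.cast_nonneg _
  have hc16 : c ≤ 1 / 16 := by nlinarith
  have hB : ∀ j, volume (B j) ≤ ENNReal.ofReal (116 * c * (ρ / 2)) := by
    intro j
    have h1 := volume_near_rationals_le (a := z j - z i + r + ρ / 2) (half_pos hρ) hc hc16
    rw [← (show MeasurePreserving (MeasurableEquiv.subLeft (z j)) volume volume from
      Measure.measurePreserving_sub_left volume (z j)).measure_preimage_equiv] at h1
    refine (measure_mono ?_).trans h1
    rintro u ⟨hu, r', h2, h3⟩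
    refine ⟨?_, r', h2, h3⟩
    change z j - u ∈ Icc _ _
    constructor <;> linarith [hu.1, hu.2]
  -- With N coordinates the bad sets fill at most the fraction 116Nc < 1 of the interval, and
  -- non-generic points are null.
  obtain ⟨u, hu, huB⟩ : ∃ u, (u ∈ J ∧ u ∈ G) ∧ u ∉ ⋃ j, B j := by
    by_contra! h
    have h1 : volume J ≤ volume (⋃ j, B j) := by
      refine measure_mono_ae ?_
      filter_upwards [hG] with u hu huJ using h u ⟨huJ, hu⟩
    have h2 : volume (⋃ j, B j) ≤ ENNReal.ofReal (Fintype.card ι * (116 * c * (ρ / 2))) := by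
      refine (measure_iUnion_fintype_le _ _).trans ((Finset.sum_le_sum fun j _ => hB j).trans ?_)
      rw [Finset.sum_const, nsmul_eq_mul, ENNReal.ofReal_mul hN, ENNReal.ofReal_natCast]
      rfl
    have h3 := h1.trans h2
    rw [Real.volume_Ioo, ENNReal.ofReal_le_ofReal_iff (by positivity)] at h3
    have h4 : 0 < c * ρ := by positivity
    have h5 := mul_le_mul_of_nonneg_right hcN hρ.le
    nlinarith [mul_nonneg hN h4.le]
  obtain ⟨⟨hu1, hu2⟩, huG⟩ := hu
  refine ⟨u, huG, by linarith, by linarith, fun j r' h1 h2 => ?_⟩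
  have hd := rat_den_pos r'
  rcases le_or_gt (1 / (r'.den : ℝ) ^ 3) (8 * (ρ / 2)) with h3 | h3
  · by_contra! h4
    exact huB (mem_iUnion.2 ⟨j, ⟨hu1, hu2⟩, r', h3, h4⟩)
  -- Here ρ < q'^(-3) / 4, so moving by at most ρ cannot spoil the separation supplied by `hr`.
  · have h4 := hr j r' h1 h2
    have h5 : |z j - z i + r - r'| ≤ |z j - u - r'| + |z i - u - r| := by
      have : z j - z i + r - r' = (z j - u - r') - (z i - u - r) := by ring
      rw [this]
      exact abs_sub _ _
    have h6 : |z i - u - r| ≤ ρ := by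
      rw [abs_le]
      constructor <;> linarith
    have h7 : c / (r'.den : ℝ) ^ 3 ≤ 1 / 16 * (1 / (r'.den : ℝ) ^ 3) := by
      rw [div_eq_mul_one_div]
      exact mul_le_mul_of_nonneg_right hc16 (by positivity)
    linarith

/-- From a generic point `u` one can pass to a rational `r` of large denominator that is close to
`z i - u` and has no further coincidences. -/
theorem exists_generic_rat (z : ι → ℝ) {u : ℝ} (hu : u ∈ genericSet z) (i : ι) (B : ℕ) :
    ∃ r : ℚ, B ≤ r.den ∧ |z i - u - r| ≤ 1 / (r.den : ℝ) ^ 2 ∧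
      ∀ (j : ι) (r' : ℚ), r.den ≤ r'.den ^ 2 → (j = i → r' ≠ r) →
        1 / (r'.den : ℝ) ^ 3 ≤ |z j - z i + r - r'| := by
  obtain ⟨hirr, hfin⟩ := hu i
  have hbad : (⋃ j : {j // i ≠ j}, Prod.fst '' resonances (z j - z i) (z i - u)).Finite :=
    finite_iUnion fun j => (hfin j j.2).image _
  obtain ⟨r, ⟨hr, hr1⟩, hr2⟩ :=
    (((Real.infinite_rat_abs_sub_lt_one_div_den_sq_of_irrational hirr).sdiff
      (finite_setOf_rat_den_le (z i - u) 1 B)).sdiff hbad).nonempty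
  have hr' : |z i - u - r| < 1 / (r.den : ℝ) ^ 2 := hr
  refine ⟨r, ?_, hr'.le, fun j r' h1 h2 => ?_⟩
  · by_contra! h
    exact hr1 ⟨h.le, hr'.le.trans (one_div_den_pow_le_one _ _)⟩
  · by_cases hij : i = j
    · subst hij
      -- In the same coordinate no genericity is needed: distinct rationals differ by at least
      -- 1/(qq') ≥ 1/q'^3, as q ≤ q'^2.
      have h3 := one_div_den_mul_den_le_abs_sub (h2 rfl).symm
      rw [sub_self, zero_add]
      refine le_trans ?_ h3
      have hd := rat_den_pos r
      have hd' := rat_den_pos r'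
      refine one_div_le_one_div_of_le (by positivity) ?_
      have : (r.den : ℝ) ≤ (r'.den : ℝ) ^ 2 := by exact_mod_cast h1
      nlinarith
    · by_contra! h3
      exact hr2 (mem_iUnion.2 ⟨⟨j, hij⟩, ⟨(r, r'), ⟨hr'.le, h1, h3⟩, rfl⟩⟩)

/-- The conditions on a rational `r` and a point `u` at a stage of the construction, where
`z i - u - r` has size `ρ`. -/
structure IsStage (z : ι → ℝ) (c : ℝ) (i : ι) (τ : ℝ) (r : ℚ) (u : ℝ) : Prop where
  generic : u ∈ genericSet z
  lower : (r.den : ℝ) ^ (-τ) / 2 < z i - u - r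
  upper : z i - u - r < (r.den : ℝ) ^ (-τ)
  far : ∀ (j : ι) (r' : ℚ), r.den ≤ r'.den ^ 2 → (j = i → r' ≠ r) →
    c / (r'.den : ℝ) ^ 3 ≤ |z j - u - r'|

theorem exists_isStage {z : ι → ℝ} (hz : ∀ᵐ u : ℝ, u ∈ genericSet z) {c : ℝ} (hc : 0 < c)
    (hcN : 200 * (Fintype.card ι + 1) * c ≤ 1) {u : ℝ} (hu : u ∈ genericSet z) (i : ι) (τ : ℝ)
    (B : ℕ) : ∃ (r : ℚ) (u' : ℝ), B ≤ r.den ∧ |z i - u - r| ≤ 1 / (r.den : ℝ) ^ 2 ∧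
      IsStage z c i τ r u' := by
  obtain ⟨r, h1, h2, h3⟩ := exists_generic_rat z hu i B
  obtain ⟨u', h4, h5, h6, h7⟩ := exists_generic_point z hz i r
    (Real.rpow_pos_of_pos (rat_den_pos r) (-τ)) hc hcN h3
  exact ⟨r, u', h1, h2, h4, h5, h6, h7⟩

/-- The closed interval around `z i - r` in which the construction continues. -/
def stageSet (z : ι → ℝ) (i : ι) (τ : ℝ) (r : ℚ) : Set ℝ :=
  {x | (r.den : ℝ) ^ (-τ) / 2 ≤ z i - x - r ∧ z i - x - r ≤ (r.den : ℝ) ^ (-τ)}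

/-- The new rational approximates z i' - u for the current generic u, so the new interval lies
within 2/q₁² of u. It therefore fits inside the old one and inherits the separation at u for all
q'^2 ≤ q₁. -/
theorem exists_next_isStage {z : ι → ℝ} (hz : ∀ᵐ u : ℝ, u ∈ genericSet z) {c : ℝ} (hc : 0 < c)
    (hcN : 200 * (Fintype.card ι + 1) * c ≤ 1) {i i' : ι} {τ τ' : ℝ} (hτ' : 2 ≤ τ') {r : ℚ} {u : ℝ}
    (h : IsStage z c i τ r u) :
    ∃ (r₁ : ℚ) (u₁ : ℝ), IsStage z c i' τ' r₁ u₁ ∧ r.den < r₁.den ∧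
      stageSet z i' τ' r₁ ⊆ stageSet z i τ r ∧
      ∀ x ∈ stageSet z i' τ' r₁, ∀ (j : ι) (r' : ℚ), r.den ≤ r'.den ^ 2 → r'.den ^ 2 ≤ r₁.den →
        (j = i → r' ≠ r) → c / 2 / (r'.den : ℝ) ^ 3 ≤ |z j - x - r'| := by
  set η := min (z i - u - r - (r.den : ℝ) ^ (-τ) / 2) ((r.den : ℝ) ^ (-τ) - (z i - u - r))
  have hη : 0 < η := lt_min (sub_pos.2 h.lower) (sub_pos.2 h.upper)
  -- The bound 2/η gives nesting; 16/c² gives 2/q₁² ≤ (c/2)/q'^3 when q'^2 ≤ q₁, so only half of c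
  -- is lost.
  obtain ⟨B, hB⟩ := exists_nat_ge (max (2 / η) (16 / c ^ 2))
  obtain ⟨r₁, u₁, h1, h2, h3⟩ := exists_isStage hz hc hcN h.generic i' τ' (max B (r.den + 1))
  have hB1 : B ≤ r₁.den := (le_max_left _ _).trans h1
  have hBr : (B : ℝ) ≤ r₁.den := by exact_mod_cast hB1
  have hd := rat_den_pos r₁
  have hd1 : (1 : ℝ) ≤ r₁.den := by exact_mod_cast r₁.den_pos
  have hη1 : 2 / (r₁.den : ℝ) ^ 2 ≤ η := by
    have := ((le_max_left _ _).trans hB).trans hBr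
    rw [div_le_iff₀ hη] at this
    rw [div_le_iff₀ (by positivity)]
    nlinarith
  have hc1 : 16 ≤ c ^ 2 * r₁.den := by
    have := ((le_max_right _ _).trans hB).trans hBr
    rw [div_le_iff₀ (by positivity)] at this
    linarith
  have hclose : ∀ x ∈ stageSet z i' τ' r₁, |x - u| ≤ 2 / (r₁.den : ℝ) ^ 2 := by
    intro x hx
    have e1 : (r₁.den : ℝ) ^ (-τ') ≤ 1 / (r₁.den : ℝ) ^ 2 := by
      rw [one_div, ← Real.rpow_natCast, ← Real.rpow_neg hd.le]
      exact Real.rpow_le_rpow_of_exponent_le hd1 (by push_cast; linarith)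
    have e2 : 0 < (r₁.den : ℝ) ^ (-τ') := by positivity
    have e3 : |z i' - x - r₁| ≤ 1 / (r₁.den : ℝ) ^ 2 := by
      rw [abs_le]
      constructor <;> linarith [hx.1, hx.2]
    have e4 : x - u = (z i' - u - r₁) - (z i' - x - r₁) := by ring
    rw [e4]
    refine (abs_sub _ _).trans ((add_le_add h2 e3).trans (le_of_eq (by ring)))
  refine ⟨r₁, u₁, h3, (le_max_right _ _).trans h1, fun x hx => ?_, fun x hx j r' h4 h5 h6 => ?_⟩
  · have e1 := abs_le.1 ((hclose x hx).trans hη1)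
    have e2 : η ≤ z i - u - r - (r.den : ℝ) ^ (-τ) / 2 := min_le_left _ _
    have e3 : η ≤ (r.den : ℝ) ^ (-τ) - (z i - u - r) := min_le_right _ _
    constructor <;> linarith [e1.1, e1.2]
  · have e1 := h.far j r' h4 h6
    have hd' := rat_den_pos r'
    have e2 : 2 / (r₁.den : ℝ) ^ 2 ≤ c / 2 / (r'.den : ℝ) ^ 3 := by
      rw [div_div, div_le_div_iff₀ (by positivity) (by positivity)]
      have e5 : (r'.den : ℝ) ^ 2 ≤ r₁.den := by exact_mod_cast h5
      refine le_of_sq_le_sq ?_ (by positivity)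
      calc (2 * (2 * (r'.den : ℝ) ^ 3)) ^ 2 = 16 * ((r'.den : ℝ) ^ 2) ^ 3 := by ring
        _ ≤ 16 * (r₁.den : ℝ) ^ 3 := by gcongr
        _ ≤ (c ^ 2 * r₁.den) * (r₁.den : ℝ) ^ 3 := by gcongr
        _ = (c * (r₁.den : ℝ) ^ 2) ^ 2 := by ring
    have e3 : |z j - u - r'| ≤ |z j - x - r'| + |x - u| := by
      have : z j - u - r' = (z j - x - r') + (x - u) := by ring
      rw [this]
      exact abs_add_le _ _
    have e4 := hclose x hx
    have e6 : c / (r'.den : ℝ) ^ 3 = c / 2 / (r'.den : ℝ) ^ 3 + c / 2 / (r'.den : ℝ) ^ 3 := by ring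
    linarith

theorem isCompact_stageSet {κ : Type*} (z : κ → ℝ) (i : κ) (τ : ℝ) (r : ℚ) :
    IsCompact (stageSet z i τ r) := by
  have : stageSet z i τ r =
      Icc (z i - r - (r.den : ℝ) ^ (-τ)) (z i - r - (r.den : ℝ) ^ (-τ) / 2) := by
    ext x
    constructor
    · rintro ⟨h1, h2⟩
      constructor <;> linarith
    · rintro ⟨h1, h2⟩
      constructor <;> linarith
  rw [this]
  exact isCompact_Icc

/-- For generic `z` and a prescribed sequence of coordinates and exponents `≥ 2` there is `x` such
that the coordinates of `z - x` are approximated according to these data, and not better. -/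
theorem exists_approximation_sequence {z : ι → ℝ} (hz : ∀ᵐ u : ℝ, u ∈ genericSet z)
    (idx : ℕ → ι) (T : ℕ → ℝ) (hT : ∀ k, 2 ≤ T k) :
    ∃ (x c : ℝ) (r : ℕ → ℚ), 0 < c ∧ StrictMono (fun k => (r k).den) ∧
      (∀ k, x ∈ stageSet z (idx k) (T k) (r k)) ∧
      ∀ (k : ℕ) (j : ι) (r' : ℚ), (r k).den ≤ r'.den ^ 2 → r'.den ^ 2 ≤ (r (k + 1)).den →
        (j = idx k → r' ≠ r k) → c / (r'.den : ℝ) ^ 3 ≤ |z j - x - r'| := by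
  set c : ℝ := 1 / (200 * (Fintype.card ι + 1))
  have hc : 0 < c := by positivity
  have hcN : 200 * (Fintype.card ι + 1) * c ≤ 1 := by
    simp only [c]
    rw [mul_one_div_cancel (by positivity)]
  obtain ⟨u₀, hu₀⟩ := hz.exists
  obtain ⟨ra, ua, -, -, ha⟩ := exists_isStage hz hc hcN hu₀ (idx 0) (T 0) 0
  let State : ℕ → Type := fun k => {s : ℚ × ℝ // IsStage z c (idx k) (T k) s.1 s.2}
  have hnext : ∀ k (s : State k), ∃ s' : State (k + 1), s.1.1.den < s'.1.1.den ∧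
      stageSet z (idx (k + 1)) (T (k + 1)) s'.1.1 ⊆ stageSet z (idx k) (T k) s.1.1 ∧
      ∀ x ∈ stageSet z (idx (k + 1)) (T (k + 1)) s'.1.1, ∀ (j : ι) (r' : ℚ),
        s.1.1.den ≤ r'.den ^ 2 → r'.den ^ 2 ≤ s'.1.1.den → (j = idx k → r' ≠ s.1.1) →
          c / 2 / (r'.den : ℝ) ^ 3 ≤ |z j - x - r'| := by
    intro k s
    obtain ⟨r₁, u₁, h1, h2, h3, h4⟩ := exists_next_isStage hz hc hcN (i' := idx (k + 1))
      (hT (k + 1)) s.2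
    exact ⟨⟨(r₁, u₁), h1⟩, h2, h3, h4⟩
  choose next hnext using hnext
  let s : ∀ k, State k := fun k => Nat.rec ⟨(ra, ua), ha⟩ next k
  obtain ⟨x, hx⟩ := IsCompact.nonempty_iInter_of_sequence_nonempty_isCompact_isClosed
    (fun k => stageSet z (idx k) (T k) (s k).1.1) (fun k => (hnext k (s k)).2.1)
    (fun k => ⟨(s k).1.2, (s k).2.lower.le, (s k).2.upper.le⟩)
    (isCompact_stageSet _ _ _ _) (fun k => (isCompact_stageSet _ _ _ _).isClosed)
  rw [mem_iInter] at hx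
  exact ⟨x, c / 2, fun k => (s k).1.1, half_pos hc,
    strictMono_nat_of_lt_succ fun k => (hnext k (s k)).1, hx,
    fun k => (hnext k (s k)).2.2 x (hx (k + 1))⟩

end Construction

/-! ### Prescribing all exponents simultaneously -/

section LevelSets

theorem exists_sub_mem_W {n : ℕ} (l m : Fin n → ℝ≥0∞) (hl : ∀ i, 2 ≤ l i) (hlm : ∀ i, l i ≤ m i)
    (hm : ∀ i, 3 ≤ m i) {z : Fin n → ℝ} (hz : ∀ᵐ u : ℝ, u ∈ genericSet z) :
    ∃ x : ℝ, ∀ i, z i - x ∈ W (l i) (m i) := by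
  rcases Nat.eq_zero_or_pos n with rfl | hn
  · exact ⟨0, fun i => i.elim0⟩
  -- Coordinates are visited cyclically, each infinitely often. An infinite target exponent is
  -- replaced by k + 2, which is at least 2 and unbounded.
  let idx : ℕ → Fin n := fun k => ⟨k % n, Nat.mod_lt _ hn⟩
  let T : ℕ → ℝ := fun k => if l (idx k) = ∞ then k + 2 else (l (idx k)).toReal
  have hT : ∀ k, 2 ≤ T k := by
    intro k
    by_cases h : l (idx k) = ∞
    · simp only [T, if_pos h]
      linarith [(Nat.cast_nonneg k : (0 : ℝ) ≤ k)]
    · simp only [T, if_neg h]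
      exact (ENNReal.toReal_ofNat 2).symm.le.trans (ENNReal.toReal_mono h (hl _))
  obtain ⟨x, c, r, hc, hmono, hx, hfar⟩ := exists_approximation_sequence hz idx T hT
  have hclose : ∀ k, |z (idx k) - x - r k| ≤ ((r k).den : ℝ) ^ (-T k) := by
    intro k
    obtain ⟨h1, h2⟩ := hx k
    have := Real.rpow_pos_of_pos (rat_den_pos (r k)) (-T k)
    rw [abs_le]
    constructor <;> linarith
  have hinj : Function.Injective r := fun a b h => hmono.injective (congrArg Rat.den h)
  refine ⟨x, fun i => ⟨?_, ?_⟩⟩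
  · have key : ∀ t : ℝ≥0, (∃ K : ℕ, ∀ k ≥ K, idx k = i → (t : ℝ) ≤ T k) →
        (t : ℝ≥0∞) ≤ irrationalityExponent (z i - x) := by
      rintro t ⟨K, hK⟩
      refine le_irrationalityExponent ?_
      have hinf : (range fun k : ℕ => r (i + n * (k + K))).Infinite := by
        refine infinite_range_of_injective fun a b h => ?_
        have := hinj h
        have h2 : n * (a + K) = n * (b + K) := by omega
        have := Nat.eq_of_mul_eq_mul_left hn h2
        omega
      refine hinf.mono ?_
      rintro _ ⟨k, rfl⟩
      have hi : idx (i + n * (k + K)) = i := by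
        apply Fin.ext
        simp only [idx, Nat.add_mul_mod_self_left]
        exact Nat.mod_eq_of_lt i.2
      have h1 := hclose (i + n * (k + K))
      rw [hi] at h1
      refine h1.trans (Real.rpow_le_rpow_of_exponent_le ?_ (neg_le_neg (hK _ ?_ hi)))
      · exact_mod_cast (r _).den_pos
      · nlinarith
    by_cases h : l i = ∞
    · rw [h]
      refine le_of_forall_lt fun b hb => ?_
      obtain ⟨t, hbt, -⟩ := ENNReal.lt_iff_exists_nnreal_btwn.1 hb
      refine hbt.trans_le (key t ?_)
      obtain ⟨K, hK⟩ := exists_nat_ge (t : ℝ)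
      refine ⟨K, fun k hk hi => ?_⟩
      have h3 : (K : ℝ) ≤ k := by exact_mod_cast hk
      simp only [T, hi, if_pos h]
      linarith
    · have h1 := key (l i).toNNReal ⟨0, fun k _ hi => by
        simp only [T, hi, if_neg h]
        exact le_rfl⟩
      rwa [ENNReal.coe_toNNReal h] at h1
  · by_cases h : l i = ∞
    · exact le_top.trans (h ▸ hlm i)
    refine le_trans ?_ (max_le (hlm i) (hm i))
    set s : ℝ≥0 := max (l i).toNNReal 3
    have hs : (s : ℝ≥0∞) = max (l i) 3 := by
      simp [s, ENNReal.coe_max, ENNReal.coe_toNNReal h]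
    have hsl : (l i).toReal ≤ s := by
      exact_mod_cast (le_max_left _ _ : (l i).toNNReal ≤ s)
    have hs3 : (3 : ℝ) ≤ s := by
      exact_mod_cast (le_max_right _ _ : (3 : ℝ≥0) ≤ s)
    rw [← hs]
    refine irrationalityExponent_le (lt_min hc one_half_pos) (B := (r 0).den)
      fun r' hr' => ?_
    have hd := rat_den_pos r'
    have hd1 : (1 : ℝ) ≤ r'.den := by exact_mod_cast r'.den_pos
    have hsq : r'.den ≤ r'.den ^ 2 := Nat.le_self_pow (by norm_num) _
    -- Stage k controls the denominators whose squares lie between those of r k and r (k + 1). The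
    -- only rational exempt from the cubic bound is r k in coordinate `idx k`, where the lower end
    -- of the stage interval applies.
    obtain ⟨k, hk1, hk2⟩ : ∃ k, (r k).den ≤ r'.den ^ 2 ∧ r'.den ^ 2 < (r (k + 1)).den := by
      have hex : ∃ k, r'.den ^ 2 < (r k).den :=
        ⟨r'.den ^ 2 + 1, (Nat.lt_succ_self _).trans_le (hmono.le_apply)⟩
      have h0 : Nat.find hex ≠ 0 := by
        intro h0
        have := Nat.find_spec hex
        rw [h0] at this
        omega
      obtain ⟨k, hk⟩ := Nat.exists_eq_succ_of_ne_zero h0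
      refine ⟨k, ?_, ?_⟩
      · have := Nat.find_min hex (m := k) (by omega)
        omega
      · have := Nat.find_spec hex
        rwa [hk] at this
    by_cases hcase : i = idx k ∧ r' = r k
    · obtain ⟨hi, rfl⟩ := hcase
      have hTk : T k = (l i).toReal := by
        simp only [T, ← hi, if_neg h]
      have h1 := (hx k).1
      rw [← hi, hTk] at h1
      refine le_trans ?_ (h1.trans (le_abs_self _))
      have h2 := Real.rpow_le_rpow_of_exponent_le hd1 (neg_le_neg hsl)
      have h3 := mul_le_mul (min_le_right c (1 / 2)) h2 (by positivity) one_half_pos.le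
      linarith
    · refine le_trans ?_ (hfar k i r' hk1 hk2.le fun h1 h2 => hcase ⟨h1, h2⟩)
      have h2 : ((r'.den : ℝ) ^ 3)⁻¹ = (r'.den : ℝ) ^ (-3 : ℝ) := by
        rw [Real.rpow_neg hd.le, Real.rpow_ofNat]
      rw [div_eq_mul_inv c, h2]
      exact mul_le_mul (min_le_left _ _)
        (Real.rpow_le_rpow_of_exponent_le hd1 (by linarith)) (by positivity) hc.le

end LevelSets

/-! ### Dimension bounds for the product sets -/

section Dimension

variable {n : ℕ} {l m : Fin n → ℝ≥0∞}

theorem le_dimH_of_ae_mem {S : Set (Fin n → ℝ)} (h : ∀ᵐ z, z ∈ S) : (n : ℝ≥0∞) ≤ dimH S := by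
  have h1 : (volume : Measure (Fin n → ℝ)) S ≠ 0 := by
    intro h0
    have h2 : ∀ᵐ z : Fin n → ℝ, z ∉ S := by rw [ae_iff]; simpa using h0
    obtain ⟨z, hz⟩ := (h.and h2).exists
    exact hz.2 hz.1
  rw [← hausdorffMeasure_pi_real] at h1
  have := le_dimH_of_hausdorffMeasure_ne_zero (d := (n : ℝ≥0)) (s := S) (by simpa using h1)
  exact_mod_cast this

/-- Adding a common real number to all coordinates maps `prodW` × ℝ Lipschitz-continuously onto
almost all of ℝⁿ, and the line costs at most 1 in packing dimension. -/
theorem le_dimH_prodW_add_one (hl : ∀ i, 2 ≤ l i) (hlm : ∀ i, l i ≤ m i) (hm : ∀ i, 3 ≤ m i) :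
    (n : ℝ≥0∞) ≤ dimH (prodW l m) + 1 := by
  let f : EuclideanSpace ℝ (Fin n) × ℝ → (Fin n → ℝ) := fun p i => p.1 i + p.2
  have hf : LipschitzWith 2 f := by
    refine LipschitzWith.of_dist_le_mul fun p q => ?_
    refine (dist_pi_le_iff (by positivity)).2 fun i => ?_
    have h1 : dist (p.1 i) (q.1 i) ≤ dist p q :=
      ((EuclideanSpace.dist_eq p.1 q.1).symm ▸ Real.le_sqrt_of_sq_le
        (Finset.single_le_sum (f := fun i => dist (p.1 i) (q.1 i) ^ 2)
          (fun _ _ => sq_nonneg _) (Finset.mem_univ i))).trans (le_max_left _ _)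
    have h2 : dist p.2 q.2 ≤ dist p q := le_max_right _ _
    refine (dist_add_add_le _ _ _ _).trans ?_
    push_cast
    linarith
  have hae : ∀ᵐ z : Fin n → ℝ, z ∈ f '' (prodW l m ×ˢ univ) := by
    filter_upwards [ae_mem_genericSet (ι := Fin n)] with z hz
    obtain ⟨x, hx⟩ := exists_sub_mem_W l m hl hlm hm hz
    refine ⟨(WithLp.toLp 2 fun i => z i - x, x), ⟨fun i => hx i, mem_univ _⟩, ?_⟩
    ext i
    simp [f]
  refine (le_dimH_of_ae_mem hae).trans ((hf.dimH_image_le _).trans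
    ((dimH_prod_le _ _).trans (add_le_add le_rfl ?_)))
  simpa using dimPacking_le_finrank (univ : Set ℝ)

theorem dimH_prodW_le {n : ℕ} {l m : Fin (n + 1) → ℝ≥0∞} (i : Fin (n + 1)) (hl : l i ≠ 0) :
    dimH (prodW l m) ≤ 2 / l i + n := by
  let f : ℝ × (Fin n → ℝ) → (Fin (n + 1) → ℝ) := fun p => i.insertNth p.1 p.2
  have hf : LipschitzWith 1 f := by
    refine LipschitzWith.of_dist_le_mul fun p q => ?_
    rw [NNReal.coe_one, one_mul]
    refine (dist_pi_le_iff dist_nonneg).2 fun j => ?_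
    rcases Fin.eq_self_or_eq_succAbove i j with rfl | ⟨k, rfl⟩
    · simp only [f, Fin.insertNth_apply_same]
      exact le_max_left _ _
    · simp only [f, Fin.insertNth_apply_succAbove]
      exact (dist_le_pi_dist p.2 q.2 k).trans (le_max_right _ _)
  let e := (EuclideanSpace.equiv (Fin (n + 1)) ℝ)
  have hsub : e '' prodW l m ⊆ f '' (W (l i) (m i) ×ˢ univ) := by
    rintro _ ⟨x, hx, rfl⟩
    refine ⟨(x i, fun k => x (i.succAbove k)), ⟨hx i, mem_univ _⟩, ?_⟩
    ext j
    rcases Fin.eq_self_or_eq_succAbove i j with rfl | ⟨k, rfl⟩ <;> simp [f, e]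
  rw [← e.dimH_image]
  refine (dimH_mono hsub).trans ((hf.dimH_image_le _).trans
    ((dimH_prod_le _ _).trans (add_le_add (dimH_W_le hl) ?_)))
  simpa using dimPacking_le_finrank (univ : Set (Fin n → ℝ))

theorem dimPacking_prodW_le : dimPacking (prodW l m) ≤ n := by
  simpa using dimPacking_le_finrank (prodW l m)

theorem le_dimPacking_prodW (hl : ∀ i, 2 ≤ l i) (hlm : ∀ i, l i ≤ m i) (hm : ∀ i, 3 ≤ m i) :
    (n : ℝ≥0∞) ≤ dimPacking (prodW l m) := by
  -- The extra coordinate has exponent ∞: it raises the ambient dimension by 1 but has Hausdorff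
  -- dimension 0.
  have h1 := le_dimH_prodW_add_one (l := Fin.cons ∞ l) (m := Fin.cons ∞ m)
    (Fin.cases (by simp) (by simpa using hl)) (Fin.cases (by simp) (by simpa using hlm))
    (Fin.cases (by simp) (by simpa using hm))
  rw [Nat.cast_add, Nat.cast_one] at h1
  have h2 := ENNReal.le_of_add_le_add_right ENNReal.one_ne_top h1
  let e := (EuclideanSpace.equiv (Fin (n + 1)) ℝ)
  let f : ℝ × EuclideanSpace ℝ (Fin n) → (Fin (n + 1) → ℝ) := fun p => Fin.cons p.1 p.2
  have hf : LipschitzWith 1 f := by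
    refine LipschitzWith.of_dist_le_mul fun p q => ?_
    rw [NNReal.coe_one, one_mul]
    refine (dist_pi_le_iff dist_nonneg).2 fun j => ?_
    refine Fin.cases ?_ (fun k => ?_) j
    · exact (le_max_left _ _ : _ ≤ dist p q)
    · refine le_trans ?_ (le_max_right _ _ : _ ≤ dist p q)
      rw [EuclideanSpace.dist_eq]
      exact Real.le_sqrt_of_sq_le (Finset.single_le_sum
        (f := fun i => dist (p.2 i) (q.2 i) ^ 2) (fun _ _ => sq_nonneg _) (Finset.mem_univ k))
  have hsub : e '' prodW (Fin.cons ∞ l) (Fin.cons ∞ m) ⊆ f '' (W ∞ ∞ ×ˢ prodW l m) := by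
    rintro _ ⟨x, hx, rfl⟩
    refine ⟨(x 0, WithLp.toLp 2 fun k => x k.succ), ⟨hx 0, fun k => hx k.succ⟩, ?_⟩
    ext j
    refine Fin.cases ?_ (fun k => ?_) j <;> simp [f, e]
  have h3 : dimH (W ∞ ∞) = 0 := by
    have := dimH_W_le (l := ∞) (m := ∞) (by simp)
    simpa using this
  calc (n : ℝ≥0∞) ≤ dimH (e '' prodW (Fin.cons ∞ l) (Fin.cons ∞ m)) := by rwa [e.dimH_image]
    _ ≤ dimH (f '' (W ∞ ∞ ×ˢ prodW l m)) := dimH_mono hsub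
    _ ≤ dimH (W ∞ ∞) + dimPacking (prodW l m) := (hf.dimH_image_le _).trans (dimH_prod_le _ _)
    _ = dimPacking (prodW l m) := by rw [h3, zero_add]

end Dimension

/-! ### What admissibility is used for -/

section Admissible

/-- Some `l j` exceeds 3, and then `m j` ≥ `l j` > 3. For i ≠ j with `l i` finite, the product of
all `l k` is at least 2 `l i`, so its quotient by `l i` - 1 is at least 2. -/
theorem three_le_of_admissible {n : ℕ} {p : (Fin n → ℝ≥0∞) × (Fin n → ℝ≥0∞)}
    (hp : p ∈ admissible n) (hsup : 3 < ⨆ i, p.1 i) (i : Fin n) : 3 ≤ p.2 i := by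
  obtain ⟨h2, hle, h | h⟩ := hp i
  · simp [h]
  by_cases htop : p.1 i = ∞
  · exact le_top.trans (htop ▸ hle)
  obtain ⟨j, hj⟩ := lt_iSup_iff.1 hsup
  by_cases hij : i = j
  · subst hij
    exact hj.le.trans hle
  refine le_trans ?_ h.le
  have hprod : p.1 i * 2 ≤ ∏ k, p.1 k := by
    rw [← Finset.mul_prod_erase Finset.univ p.1 (Finset.mem_univ i)]
    refine mul_le_mul' le_rfl ?_
    rw [← Finset.mul_prod_erase _ p.1 (Finset.mem_erase.2 ⟨Ne.symm hij, Finset.mem_univ j⟩)]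
    refine (hp j).1.trans (le_mul_of_one_le_right zero_le (Finset.one_le_prod' fun k _ => ?_))
    exact one_le_two.trans (hp k).1
  have h1 : (2 : ℝ≥0∞) ≤ (∏ k, p.1 k) / (p.1 i - 1) := by
    rw [ENNReal.le_div_iff_mul_le]
    · refine le_trans ?_ hprod
      rw [mul_comm]
      exact mul_le_mul' tsub_le_self le_rfl
    · left
      rw [Ne, tsub_eq_zero_iff_le, not_le]
      exact ENNReal.one_lt_two.trans_le h2
    · left
      exact ENNReal.sub_ne_top htop
  calc (3 : ℝ≥0∞) = 2 + 1 := by norm_num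
    _ ≤ _ := by gcongr

end Admissible

end DiophProd

/-! ### The two limits -/

theorem mainTheorem7 (n : ℕ) (hn : 1 ≤ n) :
    Tendsto (fun p : (Fin n → ℝ≥0∞) × (Fin n → ℝ≥0∞) => dimH (DiophProd.prodW p.1 p.2))
        (DiophProd.maxToInfty n) (𝓝 ((n : ℝ≥0∞) - 1)) ∧
      Tendsto
        (fun p : (Fin n → ℝ≥0∞) × (Fin n → ℝ≥0∞) => DiophProd.dimPacking (DiophProd.prodW p.1 p.2))
        (DiophProd.maxToInfty n) (𝓝 (n : ℝ≥0∞)) := by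
  have hsup : Tendsto (fun p : (Fin n → ℝ≥0∞) × (Fin n → ℝ≥0∞) => ⨆ i, p.1 i)
      (DiophProd.maxToInfty n) (𝓝 ∞) := tendsto_comap.mono_left inf_le_left
  have hadm : ∀ᶠ p in DiophProd.maxToInfty n, p ∈ DiophProd.admissible n :=
    eventually_inf_principal.2 (Eventually.of_forall fun _ h => h)
  have hlarge := hsup.eventually (lt_mem_nhds (by simp : (3 : ℝ≥0∞) < ∞))
  constructor
  · have hupper : Tendsto (fun p : (Fin n → ℝ≥0∞) × (Fin n → ℝ≥0∞) =>
        2 / (⨆ i, p.1 i) + ((n : ℝ≥0∞) - 1)) (DiophProd.maxToInfty n) (𝓝 ((n : ℝ≥0∞) - 1)) := by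
      have h1 := ENNReal.Tendsto.const_div (a := 2) hsup (Or.inr (by simp))
      simpa using h1.add_const ((n : ℝ≥0∞) - 1)
    refine tendsto_of_tendsto_of_tendsto_of_le_of_le' tendsto_const_nhds hupper ?_ ?_
    · filter_upwards [hadm, hlarge] with p hp h3
      exact tsub_le_iff_right.2 (DiophProd.le_dimH_prodW_add_one (fun i => (hp i).1)
        (fun i => (hp i).2.1) (DiophProd.three_le_of_admissible hp h3))
    · filter_upwards [hadm] with p hp
      obtain ⟨k, rfl⟩ := Nat.exists_eq_add_of_le' hn
      -- The coordinate attaining the maximum gives the best upper bound.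
      obtain ⟨i, hi⟩ := exists_eq_ciSup_of_finite (f := p.1)
      rw [← hi]
      have h0 : p.1 i ≠ 0 := (lt_of_lt_of_le (by simp) (hp i).1).ne'
      simpa using DiophProd.dimH_prodW_le (m := p.2) i h0
  · refine tendsto_const_nhds.congr' ?_
    filter_upwards [hadm, hlarge] with p hp h3
    exact le_antisymm (DiophProd.le_dimPacking_prodW (fun i => (hp i).1) (fun i => (hp i).2.1)
      (DiophProd.three_le_of_admissible hp h3)) DiophProd.dimPacking_prodW_le
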